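/- In $\mathbf F_2[[q]]$ let $\Delta=\sum_{m\ge 0} q^{(2m+1)^2}$ (the reduction mod $2$ of $\sum\tau(n)q^n$). For an odd prime $p$, the Hecke operator $T_p$ sends $\sum a_nq^n$ to $\sum b_nq^n$, where $b_n=a_{pn}$ if $p\nmid n$ and $b_n=a_{pn}+a_{n/p}$ if $p\mid n$. For $n\ge 1$ let $\mathcal F(n)$ be the $\mathbf F_2$-vector space spanned by $\Delta,\Delta^3,\dots,\Delta^{2n-1}$; it is stable under all $T_p$. Let $A(n)$ be the $\mathbf F_2$-subalgebra of $\mathrm{End}(\mathcal F(n))$ generated by the $T_p$, $p$ an odd prime, and let $A=\varprojlim A(n)$ be the projective limit along restriction of endomorphisms. Each $T_p$ is then an element of $A$, and there is a continuous isomorphism of $\mathbf F_2$-algebras $\psi:\mathbf F_2[[x,y]]\to A$ with $\psi(x)=T_3$ and $\psi(y)=T_5$. Identify $A$ with $\mathbf F_2[[x,y]]$ by means of $\psi$. Then for every odd prime $p$: - if $p\equiv 1 \pmod 8$, then $T_p\in\mathbf F_2[[x^2,y^2]]$; - if $p\equiv 3 \pmod 8$, then $T_p\in x\cdot\mathbf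 F_2[[x^2,y^2]]$; - if $p\equiv 5 \pmod 8$, then $T_p\in y\cdot\mathbf F_2[[x^2,y^2]]$; - if $p\equiv 7 \pmod 8$, then $T_p\in xy\cdot\mathbf F_2[[x^2,y^2]]$. -/

import Mathlib

open scoped PowerSeries

/-- Reduction mod 2 of the discriminant form: `Δ = ∑_{m ≥ 0} q ^ ((2m+1)^2)` in `F₂[[q]]`. -/
noncomputable def Delta : (ZMod 2)⟦X⟧ :=
  open Classical in
  PowerSeries.mk fun n => if ∃ m : ℕ, n = (2 * m + 1) ^ 2 then 1 else 0

/-- The Hecke operator `T_p` on `F₂[[q]]` (for an odd prime `p`):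
`a_n(T_p f) = a_{pn}(f)` if `p ∤ n` and `a_n(T_p f) = a_{pn}(f) + a_{n/p}(f)` if `p ∣ n`.
(The usual factor `p^(k-1)` in weight `k` is `1` mod 2.) -/
noncomputable def heckeOp (p : ℕ) : (ZMod 2)⟦X⟧ →ₗ[ZMod 2] (ZMod 2)⟦X⟧ where
  toFun f := PowerSeries.mk fun n =>
    PowerSeries.coeff (p * n) f + if p ∣ n then PowerSeries.coeff (n / p) f else 0
  map_add' f g := by
    ext n
    simp only [PowerSeries.coeff_mk, map_add]
    split_ifs <;> ring
  map_smul' c f := by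
    ext n
    simp only [PowerSeries.coeff_mk, map_smul, smul_eq_mul, RingHom.id_apply]
    split_ifs <;> ring

/-- The space `F(n)` spanned by `Δ, Δ^3, …, Δ^(2n-1)` over `F₂`; `F(0) = 0`.
The union of the `F(n)` is the space spanned by all odd powers of `Δ`. -/
noncomputable def spaceF (n : ℕ) : Submodule (ZMod 2) (ZMod 2)⟦X⟧ :=
  Submodule.span (ZMod 2) {f | ∃ i : ℕ, i < n ∧ f = Delta ^ (2 * i + 1)}

theorem spaceF_le_succ (n : ℕ) : spaceF n ≤ spaceF (n + 1) := by
  refine Submodule.span_mono ?_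
  rintro f ⟨i, hi, rfl⟩
  exact ⟨i, Nat.lt_succ_of_lt hi, rfl⟩

/-- `t` is the endomorphism of `F(n)` induced by the Hecke operator `T_p`. -/
def IsInducedHecke (p n : ℕ) (t : Module.End (ZMod 2) (spaceF n)) : Prop :=
  ∀ f : spaceF n, ((t f : spaceF n) : (ZMod 2)⟦X⟧) = heckeOp p f

/-- The `F₂`-subalgebra `A(n)` of `End(F(n))` generated by the `T_p`, for `p` an odd prime. -/
noncomputable def heckeAlg (n : ℕ) : Subalgebra (ZMod 2) (Module.End (ZMod 2) (spaceF n)) :=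
  Algebra.adjoin (ZMod 2) {t | ∃ p : ℕ, p.Prime ∧ p ≠ 2 ∧ IsInducedHecke p n t}

/-- The Hecke algebra `A`, the projective limit of the `A(n)` along restriction of endomorphisms:
families `(a n)`, with `a n ∈ A(n)`, such that `a (n+1)` restricts to `a n` on `F(n)`.
(The term `A(0) = 0` does not change the limit.) -/
noncomputable def heckeLim : Subalgebra (ZMod 2) ((n : ℕ) → Module.End (ZMod 2) (spaceF n)) where
  carrier := {a | (∀ n, a n ∈ heckeAlg n) ∧
    ∀ (n : ℕ) (f : spaceF n),
      a (n + 1) (Submodule.inclusion (spaceF_le_succ n) f) =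
        Submodule.inclusion (spaceF_le_succ n) (a n f)}
  mul_mem' {a b} ha hb :=
    ⟨fun n => mul_mem (ha.1 n) (hb.1 n), fun n f => by
      simp only [Pi.mul_apply, Module.End.mul_apply, hb.2, ha.2]⟩
  add_mem' {a b} ha hb :=
    ⟨fun n => add_mem (ha.1 n) (hb.1 n), fun n f => by
      simp only [Pi.add_apply, LinearMap.add_apply, hb.2, ha.2, map_add]⟩
  algebraMap_mem' r :=
    ⟨fun n => (heckeAlg n).algebraMap_mem r, fun n f => by
      simp only [Pi.algebraMap_apply, Module.algebraMap_end_apply, map_smul]⟩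

/-- `a ∈ A` is the Hecke operator `T_p`: it acts as `T_p` on every `F(n)`. -/
def IsHecke (p : ℕ) (a : heckeLim) : Prop :=
  ∀ n : ℕ, IsInducedHecke p n (a.1 n)

/-- The power series ring `F₂[[x,y]]`, with `x = X 0` and `y = X 1`. -/
abbrev SeriesXY : Type := MvPowerSeries (Fin 2) (ZMod 2)

/-- Continuity of an algebra homomorphism `F₂[[x,y]] → A`, for the `(x,y)`-adic topology and the
projective limit topology: for each `n`, every series without terms of degree `< N`, for `N` large
enough, is sent to an element that vanishes in `A(n)`. -/
def IsContinuousHom (ψ : SeriesXY →ₐ[ZMod 2] heckeLim) : Prop :=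
  ∀ n : ℕ, ∃ N : ℕ, ∀ u : SeriesXY,
    (∀ d : Fin 2 →₀ ℕ, d 0 + d 1 < N → MvPowerSeries.coeff d u = 0) → (ψ u).1 n = 0

/-- The subring `F₂[[x²,y²]]` of `F₂[[x,y]]`: the image of `u(x,y) ↦ u(x²,y²)`. -/
noncomputable def evenSeries : Subalgebra (ZMod 2) SeriesXY :=
  (MvPowerSeries.expand (σ := Fin 2) (R := ZMod 2) 2 two_ne_zero).range

/-! The isomorphism is a duality between `F₂[[x,y]]` and the span of the odd powers of Δ, for the
pairing that sends (T, f) to the coefficient of q in T f. Split the binary digits of i into those at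
even positions, forming a, and those at odd positions, forming b. Up to terms of smaller weight
2a+3b, T_3 takes the power Δ^(2i+1) with coordinates (a, b) to the one with coordinates (a-1, b),
and T_5 takes it to the one with coordinates (a, b-1); the result is zero when the coordinate to be
lowered is 0 (`heckeThree_deltaOdd`, `heckeFive_deltaOdd`). Hence T_3^a T_5^b sends the power with
coordinates (a, b) to Δ and kills every other one of weight at most 2a+3b. The pairing matrix is
unitriangular, which gives injectivity and, since A is commutative, surjectivity.

The leading terms come from recursions. For p = 3, 5 a symmetric polynomial relation holds between
Δ(q) and Δ(q^p); its 2^s-th powers express T_p Δ^k through T_p of smaller powers. The relations are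
proved by checking that certain traces vanish, and these traces only involve T_p Δ^k for small k.
Such values are found from two constraints: T_p Δ^k is a polynomial in Δ of degree at most k
(`heckeOp_delta_pow_mem`), by lifting to level one forms with integral Fourier coefficients, and its
exponents lie in one class mod 8.

The second constraint also gives the four cases. Odd squares are 1 mod 8, so Δ^k has exponents
congruent to k, and T_p multiplies the class by p. Therefore only monomials x^a y^b with 3^a 5^b ≡ p
mod 8 occur in T_p, and this congruence fixes the parities of a and b. -/

namespace LevelOneHecke

/-! ### Hecke operators on complex modular forms of level one. -/

open UpperHalfPlane ModularForm CongruenceSubgroup Matrix.SpecialLinearGroup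
open scoped MatrixGroups ModularForm Manifold

variable (p : ℕ) [hp : Fact p.Prime]

/-- The matrix `(1 b; 0 p)`. -/
noncomputable def upperMat (b : ℤ) : GL (Fin 2) ℝ :=
  Matrix.GeneralLinearGroup.mkOfDetNeZero !![1, (b : ℝ); 0, (p : ℝ)]
    (by simp [hp.out.ne_zero])

/-- The matrix `(p 0; 0 1)`. -/
noncomputable def diagMat : GL (Fin 2) ℝ :=
  Matrix.GeneralLinearGroup.mkOfDetNeZero !![(p : ℝ), 0; 0, 1] (by simp [hp.out.ne_zero])

variable {k : ℤ} (f : ModularForm 𝒮ℒ k)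

theorem coe_mapGL (γ : SL(2, ℤ)) :
    ((mapGL ℝ γ : GL (Fin 2) ℝ) : Matrix (Fin 2) (Fin 2) ℝ) =
      !![(γ 0 0 : ℝ), γ 0 1; γ 1 0, γ 1 1] := by
  rw [mapGL_coe_matrix]
  ext i j
  fin_cases i <;> fin_cases j <;> simp

theorem coe_upperMat (b : ℤ) : (upperMat p b : Matrix (Fin 2) (Fin 2) ℝ) = !![1, (b : ℝ); 0,
    (p : ℝ)] :=
  rfl

theorem coe_diagMat : (diagMat p : Matrix (Fin 2) (Fin 2) ℝ) = !![(p : ℝ), 0; 0, 1] := rfl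

/-- Invariance of f under level one absorbs γ, so an identity between matrices of determinant p
becomes one between translates of f. -/
theorem slash_mul_slash_eq (γ δ : SL(2, ℤ)) {A B : GL (Fin 2) ℝ}
    (h : (A * mapGL ℝ δ : Matrix (Fin 2) (Fin 2) ℝ) = mapGL ℝ γ * B) :
    ((f : ℍ → ℂ) ∣[k] A) ∣[k] δ = ⇑f ∣[k] B := by
  change (⇑f ∣[k] A) ∣[k] mapGL ℝ δ = _
  rw [← SlashAction.slash_mul, show A * mapGL ℝ δ = mapGL ℝ γ * B from Units.ext h,
    SlashAction.slash_mul,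
    SlashInvariantForm.slash_action_eqn f _ (MonoidHom.mem_range.2 ⟨γ, rfl⟩)]

theorem slash_upperMat_add (b : ℤ) :
    (f : ℍ → ℂ) ∣[k] upperMat p (b + p) = ⇑f ∣[k] upperMat p b := by
  rw [← slash_mul_slash_eq f ModularGroup.T 1 (A := upperMat p (b + p)) (B := upperMat p b),
    SlashAction.slash_one]
  simp only [coe_mapGL, coe_upperMat, ModularGroup.coe_T]
  simp

theorem slash_upperMat_congr {b c : ℤ} (h : (b : ZMod p) = c) :
    (f : ℍ → ℂ) ∣[k] upperMat p b = ⇑f ∣[k] upperMat p c := by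
  have key : ∀ (n : ℤ), (f : ℍ → ℂ) ∣[k] upperMat p (c + n * p) = ⇑f ∣[k] upperMat p c := by
    intro n
    induction n using Int.induction_on with
    | zero => simp
    | succ n ih => rw [← ih, ← slash_upperMat_add p f (c + n * p)]; congr 2; ring
    | pred n ih => rw [← ih, ← slash_upperMat_add p f (c + (-n - 1) * p)]; congr 2; ring
  obtain ⟨n, hn⟩ := (ZMod.intCast_eq_intCast_iff_dvd_sub c b p).1 h.symm
  rw [← key n]
  congr 2
  linarith

/-- The sum of the weight `k` translates of `f` by the matrices of determinant `p`. -/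
noncomputable def heckeFun : ℍ → ℂ :=
  (f : ℍ → ℂ) ∣[k] diagMat p + ∑ b : ZMod p, (f : ℍ → ℂ) ∣[k] upperMat p (b.val : ℤ)

theorem heckeFun_slash_T : heckeFun p f ∣[k] ModularGroup.T = heckeFun p f := by
  have h1 : ((f : ℍ → ℂ) ∣[k] diagMat p) ∣[k] ModularGroup.T = ⇑f ∣[k] diagMat p := by
    refine slash_mul_slash_eq f (ModularGroup.T ^ (p : ℤ)) _ ?_
    simp only [coe_mapGL, coe_diagMat, ModularGroup.coe_T_zpow, ModularGroup.coe_T]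
    simp
  have h2 (b : ZMod p) : ((f : ℍ → ℂ) ∣[k] upperMat p (b.val : ℤ)) ∣[k] ModularGroup.T =
      ⇑f ∣[k] upperMat p ((b + 1).val : ℤ) := by
    rw [slash_upperMat_congr p f (b := (b + 1).val) (c := b.val + 1) (by simp)]
    refine slash_mul_slash_eq f 1 _ ?_
    simp only [coe_mapGL, coe_upperMat, ModularGroup.coe_T]
    simp [add_comm]
  rw [heckeFun, SlashAction.add_slash, SlashAction.sum_slash, h1]
  simp_rw [h2]
  congr 1
  exact Equiv.sum_comp (Equiv.addRight (1 : ZMod p))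
    fun b => (f : ℍ → ℂ) ∣[k] upperMat p (b.val : ℤ)

theorem heckeFun_slash_S : heckeFun p f ∣[k] ModularGroup.S = heckeFun p f := by
  have h1 : ((f : ℍ → ℂ) ∣[k] diagMat p) ∣[k] ModularGroup.S = ⇑f ∣[k] upperMat p 0 := by
    refine slash_mul_slash_eq f ModularGroup.S _ ?_
    simp only [coe_mapGL, coe_upperMat, coe_diagMat, ModularGroup.coe_S]
    simp
  have h0 : ((f : ℍ → ℂ) ∣[k] upperMat p 0) ∣[k] ModularGroup.S = ⇑f ∣[k] diagMat p := by
    refine slash_mul_slash_eq f ModularGroup.S _ ?_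
    simp only [coe_mapGL, coe_upperMat, coe_diagMat, ModularGroup.coe_S]
    simp
  have h2 (b : ZMod p) (hb : b ≠ 0) :
      ((f : ℍ → ℂ) ∣[k] upperMat p (b.val : ℤ)) ∣[k] ModularGroup.S =
      ⇑f ∣[k] upperMat p ((-b⁻¹).val : ℤ) := by
    -- For b b' ≡ -1 mod p, `upperMat p b` times S equals γ times `upperMat p b'` with γ = (b c; p
    -- -b'). The equation -b b' - 1 = p c is both det γ = 1 and the only nontrivial entry of this
    -- identity.
    obtain ⟨c, hc⟩ : (p : ℤ) ∣ -((b.val : ℤ) * ((-b⁻¹).val : ℤ)) - 1 := by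
      rw [← ZMod.intCast_zmod_eq_zero_iff_dvd]
      simp [hb]
    have hc' : -((b.val : ℝ) * ((-b⁻¹).val : ℝ)) - 1 = p * c := by exact_mod_cast hc
    generalize (-b⁻¹).val = b' at hc hc' ⊢
    generalize b.val = b at hc hc' ⊢
    obtain ⟨γ, hγ⟩ : ∃ γ : SL(2, ℤ), (γ : Matrix (Fin 2) (Fin 2) ℤ) = !![(b : ℤ), c; p,
        -(b' : ℤ)] :=
      ⟨⟨!![(b : ℤ), c; p, -(b' : ℤ)], by rw [Matrix.det_fin_two_of]; linarith⟩, rfl⟩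
    refine slash_mul_slash_eq f γ _ ?_
    have : (-1 : ℝ) = b * b' + c * p := by linarith
    simp only [coe_mapGL, coe_upperMat, ModularGroup.coe_S, hγ]
    simp [this, mul_comm]
  have hsum : ∑ b : ZMod p, ((f : ℍ → ℂ) ∣[k] upperMat p (b.val : ℤ)) =
      ⇑f ∣[k] upperMat p 0 + ∑ b ∈ Finset.univ.erase (0 : ZMod p),
        (f : ℍ → ℂ) ∣[k] upperMat p (b.val : ℤ) := by
    rw [← Finset.add_sum_erase _ _ (Finset.mem_univ (0 : ZMod p)), ZMod.val_zero, Nat.cast_zero]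
  rw [heckeFun, hsum, SlashAction.add_slash, SlashAction.add_slash, SlashAction.sum_slash, h1, h0]
  rw [add_left_comm]
  congr 2
  refine Finset.sum_equiv (Function.Involutive.toPerm (fun b : ZMod p => -b⁻¹) fun b => by simp)
    (fun i => by change _ ↔ -i⁻¹ ∈ _; simp) ?_
  intro b hb
  exact h2 b (Finset.ne_of_mem_erase hb)

/-- The matrices are upper triangular, so they fix the cusp at infinity. -/
theorem isBoundedAtImInfty_heckeFun : IsBoundedAtImInfty (heckeFun p f) := by
  have hf : IsBoundedAtImInfty (f : ℍ → ℂ) := ModularFormClass.bdd_at_infty f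
  have hs : ∀ s : Finset (ZMod p),
      IsBoundedAtImInfty (∑ b ∈ s, (f : ℍ → ℂ) ∣[k] upperMat p (b.val : ℤ)) := by
    intro s
    induction s using Finset.induction_on with
    | empty => simpa using zero_form_isBoundedAtImInfty
    | insert b s hb ih =>
      rw [Finset.sum_insert hb]
      exact (hf.slash k (by simp [coe_upperMat])).add ih
  exact (hf.slash k (by simp [coe_diagMat])).add (hs _)

/-- The Hecke operator `T_p` on modular forms of level one. -/
noncomputable def hecke : ModularForm 𝒮ℒ k where
  toFun := heckeFun p f
  slash_action_eq' := by
    rintro _ ⟨A, rfl⟩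
    exact SlashInvariantForm.slash_action_generators_SL2Z (heckeFun_slash_S p f)
      (heckeFun_slash_T p f) A
  holo' := by
    have hf : MDiff (f : ℍ → ℂ) := f.holo'
    have hs : ∀ s : Finset (ZMod p),
        MDiff (∑ b ∈ s, (f : ℍ → ℂ) ∣[k] upperMat p (b.val : ℤ)) := by
      intro s
      induction s using Finset.induction_on with
      | empty => simpa using! fun _ => mdifferentiableAt_const
      | insert b s hb ih =>
        rw [Finset.sum_insert hb]
        exact (hf.slash k _).add ih
    exact (hf.slash k _).add (hs _)
  bdd_at_cusps' {c} hc := by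
    rw [Subgroup.IsArithmetic.isCusp_iff_isCusp_SL2Z] at hc
    rw [OnePoint.isBoundedAt_iff_forall_SL2Z hc]
    intro γ _
    rw [SlashInvariantForm.slash_action_generators_SL2Z (heckeFun_slash_S p f)
      (heckeFun_slash_T p f)]
    exact isBoundedAtImInfty_heckeFun p f

theorem coe_hecke : ⇑(hecke p f) = heckeFun p f := rfl

end LevelOneHecke

/-! ### Fourier coefficients of `T_p f`. -/

namespace LevelOneHecke

open UpperHalfPlane ModularForm CongruenceSubgroup Matrix.SpecialLinearGroup
open scoped MatrixGroups ModularForm Manifold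

variable (p : ℕ) [hp : Fact p.Prime] {k : ℤ} (f : ModularForm 𝒮ℒ k)

theorem coe_upperMat_smul (b : ℤ) (τ : ℍ) :
    ((upperMat p b • τ : ℍ) : ℂ) = ((τ : ℂ) + b) / p := by
  have hp0 : 0 < (p : ℝ) := by exact_mod_cast hp.out.pos
  rw [coe_smul_of_det_pos (by simpa [coe_upperMat] using hp0)]
  simp [num, denom, coe_upperMat]

theorem coe_diagMat_smul (τ : ℍ) : ((diagMat p • τ : ℍ) : ℂ) = p * (τ : ℂ) := by
  have hp0 : 0 < (p : ℝ) := by exact_mod_cast hp.out.pos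
  rw [coe_smul_of_det_pos (by simpa [coe_diagMat] using hp0)]
  simp [num, denom, coe_diagMat]

/-- The slash action has the factor det^(k-1), which leaves p⁻¹ against the automorphy factor
p^(-k). This p⁻¹ later cancels the p of the character sum. -/
theorem slash_upperMat_apply (b : ℤ) (τ : ℍ) :
    ((f : ℍ → ℂ) ∣[k] upperMat p b) τ = (p : ℂ)⁻¹ * f (upperMat p b • τ) := by
  have hp0 : 0 < (p : ℝ) := by exact_mod_cast hp.out.pos
  have hpc : (p : ℂ) ≠ 0 := by exact_mod_cast hp.out.ne_zero
  have hd : (upperMat p b).det.val = (p : ℝ) := by simp [coe_upperMat]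
  rw [slash_apply, hd, σ, if_pos (by rw [hd]; exact hp0), abs_of_pos hp0]
  simp only [ContinuousAlgEquiv.refl_apply, denom, coe_upperMat]
  simp [zpow_sub₀ hpc]
  field_simp

theorem slash_diagMat_apply (τ : ℍ) :
    ((f : ℍ → ℂ) ∣[k] diagMat p) τ = (p : ℂ) ^ (k - 1) * f (diagMat p • τ) := by
  have hp0 : 0 < (p : ℝ) := by exact_mod_cast hp.out.pos
  have hd : (diagMat p).det.val = (p : ℝ) := by simp [coe_diagMat]
  rw [slash_apply, hd, σ, if_pos (by rw [hd]; exact hp0), abs_of_pos hp0]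
  simp [denom, coe_diagMat, mul_comm]

theorem sum_exp_two_pi (m : ℕ) :
    ∑ b : ZMod p, Complex.exp (2 * Real.pi * Complex.I * (m * b.val) / p) =
      if p ∣ m then (p : ℂ) else 0 := by
  have h := AddChar.sum_mulShift (m : ZMod p) (ZMod.isPrimitive_stdAddChar p)
  rw [ZMod.card] at h
  simp only [ZMod.natCast_eq_zero_iff] at h
  push_cast at h
  rw [← h]
  refine Finset.sum_congr rfl fun b _ => ?_
  have : b * (m : ZMod p) = ((m * b.val : ℕ) : ℤ) := by simp [mul_comm]
  rw [this, ZMod.stdAddChar_coe]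
  push_cast
  rfl

/-- The Fourier coefficients of `T_p f`. -/
theorem coeff_qExpansion_hecke (n : ℕ) :
    (qExpansion 1 (hecke p f)).coeff n = (qExpansion 1 f).coeff (p * n) +
      (p : ℂ) ^ (k - 1) * if p ∣ n then (qExpansion 1 f).coeff (n / p) else 0 := by
  have hp0 : p ≠ 0 := hp.out.ne_zero
  have hpc : (p : ℂ) ≠ 0 := by exact_mod_cast hp0
  set a : ℕ → ℂ := fun n => (qExpansion 1 f).coeff n with ha
  suffices ∀ τ : ℍ, HasSum (fun m ↦ (a (p * m) + (p : ℂ) ^ (k - 1) *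
      if p ∣ m then a (m / p) else 0) •
      Function.Periodic.qParam (1 : ℝ) τ ^ m) (hecke p f τ) from
    (ModularFormClass.qExpansion_coeff_unique one_pos one_mem_strictPeriods_SL this n).symm
  intro τ
  have hinj : Function.Injective fun m : ℕ => p * m :=
      fun x y h => Nat.eq_of_mul_eq_mul_left hp.out.pos h
  have hf (σ : ℍ) := ModularForm.hasSum_qExpansion f one_pos one_mem_strictPeriods_SL σ
  rw [coe_hecke, heckeFun, Pi.add_apply, add_comm, Finset.sum_apply]
  simp_rw [slash_upperMat_apply, slash_diagMat_apply, add_smul]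
  refine HasSum.add ?_ ?_
  · have h1 : HasSum (fun m => ∑ b : ZMod p, (p : ℂ)⁻¹ * (a m * Function.Periodic.qParam (1 : ℝ)
        (upperMat p (b.val : ℤ) • τ : ℍ) ^ m)) (∑ b : ZMod p,
            (p : ℂ)⁻¹ * f (upperMat p (b.val : ℤ) • τ)) :=
      hasSum_sum fun b _ => (hf _).mul_left _
    -- Orthogonality of additive characters: averaging over b keeps exactly the exponents divisible
    -- by p.
    have h2 (m : ℕ) : ∑ b : ZMod p, (p : ℂ)⁻¹ * (a m * Function.Periodic.qParam (1 : ℝ)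
        (upperMat p (b.val : ℤ) • τ : ℍ) ^ m) =
        if p ∣ m then a m * Complex.exp (2 * Real.pi * Complex.I * (m * (τ : ℂ) / p)) else 0 := by
      rw [← Finset.mul_sum, ← Finset.mul_sum]
      have : ∀ b : ZMod p, Function.Periodic.qParam (1 : ℝ) (upperMat p (b.val : ℤ) • τ : ℍ) ^ m =
          Complex.exp (2 * Real.pi * Complex.I * (m * (τ : ℂ) / p)) *
          Complex.exp (2 * Real.pi * Complex.I * (m * b.val) / p) := by
        intro b
        rw [coe_upperMat_smul, Function.Periodic.qParam, ← Complex.exp_nat_mul, ← Complex.exp_add]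
        congr 1
        push_cast
        field_simp
      simp_rw [this]
      rw [← Finset.mul_sum, sum_exp_two_pi]
      split_ifs
      · field_simp
      · simp
    simp_rw [h2] at h1
    rw [← hinj.hasSum_iff] at h1
    · convert h1 using 1
      funext m
      simp only [Function.comp_apply, dvd_mul_right, if_true, smul_eq_mul]
      rw [Function.Periodic.qParam, ← Complex.exp_nat_mul]
      congr 2
      push_cast
      field_simp
    · intro m hm
      rw [if_neg]
      rintro ⟨c, rfl⟩
      exact hm ⟨c, rfl⟩
  · have h1 := (hf (diagMat p • τ)).mul_left ((p : ℂ) ^ (k - 1))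
    rw [← hinj.hasSum_iff]
    · refine (iff_of_eq (congrArg (fun F => HasSum F _) (funext fun m => ?_))).mpr h1
      simp only [Function.comp_apply, dvd_mul_right, if_true, smul_eq_mul,
        Nat.mul_div_cancel_left _ hp.out.pos]
      rw [coe_diagMat_smul, Function.Periodic.qParam, Function.Periodic.qParam,
        ← Complex.exp_nat_mul, ← Complex.exp_nat_mul, mul_assoc]
      congr 3
      push_cast
      ring
    · intro m hm
      rw [if_neg]
      · simp
      rintro ⟨c, rfl⟩
      exact hm ⟨c, rfl⟩

end LevelOneHecke

-- Over `F₂` squaring is the substitution q ↦ q², because Frobenius fixes the coefficients.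
open PowerSeries in
theorem coeff_sq_zmod_two (f : (ZMod 2)⟦X⟧) (n : ℕ) :
    coeff n (f ^ 2) = if 2 ∣ n then coeff (n / 2) f else 0 := by
  have h := MvPowerSeries.map_frobenius_expand (σ := Unit) (p := 2) two_ne_zero (f := f)
  have h2 : f ^ 2 = PowerSeries.expand 2 two_ne_zero f := by
    rw [show f ^ 2 = _ from h.symm]
    rw [ZMod.frobenius_zmod, MvPowerSeries.map_id]
    rfl
  rw [h2, coeff_expand]

/-! ### Integrality of Δ and its reduction mod 2. -/

namespace IntegralForms

open UpperHalfPlane ModularForm CongruenceSubgroup Matrix.SpecialLinearGroup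
open scoped MatrixGroups ModularForm Manifold

open PowerSeries

/-- The series `∑ σ_k(n) q^n`, without constant term. -/
noncomputable def sigmaSeries (k : ℕ) : ℤ⟦X⟧ := mk fun n => (ArithmeticFunction.sigma k n : ℤ)

/-- The `q`-expansion of `Δ` as an integral power series. -/
noncomputable def discSeries : ℤ⟦X⟧ :=
  mk (fun n => ∑ d ∈ n.divisors, (5 * (d : ℤ) ^ 3 + 7 * (d : ℤ) ^ 5) / 12) +
    100 * sigmaSeries 3 ^ 2 + 8000 * sigmaSeries 3 ^ 3 - 147 * sigmaSeries 5 ^ 2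

theorem twelve_dvd (d : ℤ) : 12 ∣ 5 * d ^ 3 + 7 * d ^ 5 := by
  rw [← Nat.cast_ofNat, ← ZMod.intCast_zmod_eq_zero_iff_dvd _ 12]
  push_cast
  generalize (d : ZMod 12) = x
  revert x
  decide

/-- This is E₄³ - E₆² = 1728 Δ divided by 144, with E₄ = 1 + 240A and E₆ = 1 - 504B: the linear part
720A + 1008B becomes 5A + 7B, whose coefficients are divisible by 12. -/
theorem twelve_mul_discSeries :
    12 * discSeries = 5 * sigmaSeries 3 + 7 * sigmaSeries 5 + 12 * (100 * sigmaSeries 3 ^ 2 +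
      8000 * sigmaSeries 3 ^ 3 - 147 * sigmaSeries 5 ^ 2) := by
  have : (12 : ℤ⟦X⟧) * mk (fun n => ∑ d ∈ n.divisors, (5 * (d : ℤ) ^ 3 + 7 * (d : ℤ) ^ 5) / 12) =
      5 * sigmaSeries 3 + 7 * sigmaSeries 5 := by
    ext n
    rw [show (12 : ℤ⟦X⟧) = C 12 from rfl, show (5 : ℤ⟦X⟧) = C 5 from rfl,
      show (7 : ℤ⟦X⟧) = C 7 from rfl, map_add, coeff_C_mul, coeff_C_mul, coeff_C_mul, sigmaSeries,
      sigmaSeries, coeff_mk, coeff_mk, coeff_mk, ArithmeticFunction.sigma_apply,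
      ArithmeticFunction.sigma_apply]
    push_cast
    rw [Finset.mul_sum, Finset.mul_sum, Finset.mul_sum, ← Finset.sum_add_distrib]
    exact Finset.sum_congr rfl fun d _ => Int.mul_ediv_cancel' (twelve_dvd d)
  rw [discSeries, ← this]
  ring

/-- Coefficientwise inclusion of integral series in complex ones. -/
noncomputable abbrev toComplex : ℤ⟦X⟧ →+* ℂ⟦X⟧ := PowerSeries.map (Int.castRingHom ℂ)

/-- Coefficientwise reduction mod 2. -/
noncomputable abbrev modTwo : ℤ⟦X⟧ →+* (ZMod 2)⟦X⟧ := PowerSeries.map (Int.castRingHom (ZMod 2))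

theorem qExpansion_E₄ : qExpansion 1 E₄ = toComplex (1 + 240 * sigmaSeries 3) := by
  ext n
  rw [show (240 : ℤ⟦X⟧) = C 240 from rfl, coeff_map, map_add, coeff_C_mul, coeff_one,
    EisensteinSeries.E_qExpansion_coeff _ ⟨2, rfl⟩, show bernoulli 4 = -1 / 30 by decide +kernel]
  by_cases hn : n = 0
  · simp [hn, sigmaSeries]
  · simp only [hn, if_false, sigmaSeries, coeff_mk]
    push_cast
    norm_num

theorem qExpansion_E₆ : qExpansion 1 E₆ = toComplex (1 - 504 * sigmaSeries 5) := by
  ext n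
  rw [show (504 : ℤ⟦X⟧) = C 504 from rfl, coeff_map, map_sub, coeff_C_mul, coeff_one,
    EisensteinSeries.E_qExpansion_coeff _ ⟨3, rfl⟩, show bernoulli 6 = 1 / 42 by decide +kernel]
  by_cases hn : n = 0
  · simp [hn, sigmaSeries]
  · simp only [hn, if_false, sigmaSeries, coeff_mk]
    push_cast
    norm_num

theorem qExpansion_discriminant :
    qExpansion 1 ModularForm.discriminant = toComplex discSeries := by
  have h1 : (1728 : ℂ) • (⇑CuspForm.discriminant : ℍ → ℂ) =
      ⇑(ModularForm.mcast (by decide) (E₄.pow 3) : ModularForm 𝒮ℒ 12) -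
        ⇑(ModularForm.mcast (by decide) (E₆.pow 2) : ModularForm 𝒮ℒ 12) := by
    ext z
    have := discriminant_eq_E₄_cube_sub_E₆_sq z
    simp only [coe_mcast, ModularForm.coe_pow, Pi.sub_apply, Pi.pow_apply, Pi.smul_apply,
        smul_eq_mul,
      CuspForm.coe_discriminant, this]
    ring
  have h2 := congrArg (qExpansion 1) h1
  rw [ModularForm.qExpansion_smul one_pos one_mem_strictPeriods_SL,
    ModularForm.qExpansion_sub one_pos one_mem_strictPeriods_SL, ModularForm.qExpansion_mcast,
    ModularForm.qExpansion_mcast, ModularForm.qExpansion_pow one_pos one_mem_strictPeriods_SL,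
    ModularForm.qExpansion_pow one_pos one_mem_strictPeriods_SL, qExpansion_E₄, qExpansion_E₆,
    ← map_pow, ← map_pow, ← map_sub, CuspForm.coe_discriminant] at h2
  have h3 : (1 + 240 * sigmaSeries 3) ^ 3 - (1 - 504 * sigmaSeries 5) ^ 2 = 1728 * discSeries := by
    linear_combination (-144) * twelve_mul_discSeries
  rw [h3, map_mul] at h2
  have h4 : toComplex 1728 = C (1728 : ℂ) := by
    rw [show (1728 : ℤ⟦X⟧) = C 1728 from rfl, PowerSeries.map_C]
    simp
  rw [h4, ← smul_eq_C_mul] at h2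
  exact smul_right_injective _ (by norm_num : (1728 : ℂ) ≠ 0) h2

-- The involution d ↦ n/d pairs off the divisors of n, except for a square root of n.
open Classical in
theorem sum_divisors_one_zmod_two {n : ℕ} (hn : n ≠ 0) :
    ∑ _d ∈ n.divisors, (1 : ZMod 2) = if ∃ m : ℕ, n = m ^ 2 then 1 else 0 := by
  have key : ∀ s ⊆ n.divisors, (∀ d ∈ s, n / d ∈ s) → (∀ d ∈ s, n / d ≠ d) →
      ∑ _d ∈ s, (1 : ZMod 2) = 0 := by
    intro s hs h1 h2
    refine Finset.sum_involution (fun d _ => n / d) (fun _ _ => by decide) (fun d hd _ => h2 d hd)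
      (fun d hd => h1 d hd) fun d hd => ?_
    exact Nat.div_div_self (Nat.dvd_of_mem_divisors (hs hd)) hn
  have hdiv : ∀ d ∈ n.divisors, n / d ∈ n.divisors := fun d hd =>
    Nat.mem_divisors.2 ⟨Nat.div_dvd_of_dvd (Nat.dvd_of_mem_divisors hd), hn⟩
  have hfix : ∀ d ∈ n.divisors, n / d = d → n = d ^ 2 := by
    intro d hd h
    have := Nat.div_mul_cancel (Nat.dvd_of_mem_divisors hd)
    rw [h] at this
    rw [sq, this]
  split_ifs with h
  · obtain ⟨m, rfl⟩ := h
    have hm : 0 < m := Nat.pos_of_ne_zero (by rintro rfl; simp at hn)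
    have hmem : m ∈ (m ^ 2).divisors := Nat.mem_divisors.2 ⟨dvd_pow_self m two_ne_zero, hn⟩
    rw [← Finset.add_sum_erase _ _ hmem, key _ (Finset.erase_subset _ _), add_zero]
    · intro d hd
      rw [Finset.mem_erase] at hd ⊢
      refine ⟨fun h => hd.1 ?_, hdiv d hd.2⟩
      have := Nat.div_mul_cancel (Nat.dvd_of_mem_divisors hd.2)
      rw [h, sq] at this
      exact Nat.eq_of_mul_eq_mul_left hm this
    · intro d hd h
      rw [Finset.mem_erase] at hd
      have := hfix d hd.2 h
      exact hd.1 ((Nat.pow_left_injective (n := 2) (by norm_num) this).symm)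
  · exact key _ subset_rfl hdiv fun d hd h' => h ⟨d, hfix d hd h'⟩

/-- The numerator is congruent to 12d mod 24, so the quotient has the parity of d. -/
theorem intCast_div_twelve (d : ℕ) :
    ((((5 * (d : ℤ) ^ 3 + 7 * (d : ℤ) ^ 5) / 12 : ℤ)) : ZMod 2) = if Odd d then 1 else 0 := by
  obtain ⟨c, hc⟩ := twelve_dvd d
  have h24 : ((24 : ℕ) : ℤ) ∣ 5 * (d : ℤ) ^ 3 + 7 * (d : ℤ) ^ 5 - 12 * d := by
    rw [← ZMod.intCast_zmod_eq_zero_iff_dvd _ 24]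
    push_cast
    generalize (d : ZMod 24) = x
    revert x
    decide
  rw [hc, Int.mul_ediv_cancel_left _ (by norm_num)]
  rw [hc] at h24
  obtain ⟨e, he⟩ := h24
  have : c = d + 2 * e := by push_cast at he; linarith
  rw [this]
  push_cast
  rw [show (2 : ZMod 2) = 0 from rfl, zero_mul, add_zero]
  split_ifs with h
  · exact (ZMod.natCast_eq_one_iff_odd).2 h
  · exact (ZMod.natCast_eq_zero_iff_even).2 (Nat.not_odd_iff_even.1 h)

theorem modTwo_sigmaSeries_coeff {k : ℕ} (hk : k ≠ 0) (n : ℕ) : coeff n (modTwo (sigmaSeries k)) =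
    ∑ d ∈ n.divisors, if Odd d then (1 : ZMod 2) else 0 := by
  rw [coeff_map, sigmaSeries, coeff_mk, ArithmeticFunction.sigma_apply]
  push_cast
  rw [map_sum]
  refine Finset.sum_congr rfl fun d _ => ?_
  rw [map_pow, map_natCast]
  split_ifs with h
  · rw [(ZMod.natCast_eq_one_iff_odd).2 h, one_pow]
  · rw [(ZMod.natCast_eq_zero_iff_even).2 (Nat.not_odd_iff_even.1 h), zero_pow hk]

theorem modTwo_two : modTwo 2 = 0 := by
  rw [show (2 : ℤ⟦X⟧) = C 2 from rfl, PowerSeries.map_C, show Int.castRingHom (ZMod 2) 2 =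
      0 from rfl, map_zero]

/-- Mod 2 the series is S + S², where the coefficients of S count odd divisors. At an even n the
contributions of n and n/2 cancel, as these have the same odd divisors. At an odd n only S
contributes, and the number of divisors is odd exactly for squares. -/
theorem modTwo_discSeries : modTwo discSeries = Delta := by
  ext n
  have h1 : modTwo discSeries =
      modTwo (mk (fun n => ∑ d ∈ n.divisors, (5 * (d : ℤ) ^ 3 + 7 * (d : ℤ) ^ 5) / 12)) +
        modTwo (sigmaSeries 5) ^ 2 := by
    rw [discSeries, show (100 : ℤ⟦X⟧) = 2 * 50 by norm_num, show (8000 : ℤ⟦X⟧) = 2 *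
        4000 by norm_num,
      show (147 : ℤ⟦X⟧) = 2 * 74 - 1 by norm_num]
    simp only [map_add, map_sub, map_mul, modTwo_two, map_pow, map_one]
    ring
  rw [h1, map_add, coeff_sq_zmod_two, coeff_map, coeff_mk, map_sum]
  simp only [eq_intCast, intCast_div_twelve]
  rw [modTwo_sigmaSeries_coeff (by norm_num), Delta, coeff_mk]
  rcases eq_or_ne n 0 with rfl | hn
  · simp only [Nat.divisors_zero, Finset.sum_empty, dvd_zero, if_true, Nat.zero_div, add_zero]
    rw [if_neg fun ⟨m, hm⟩ => (pow_pos (Nat.succ_pos (2 * m)) 2).ne hm]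
  rcases Nat.even_or_odd n with he | ho
  · rw [if_pos he.two_dvd, if_neg]
    · have : ∑ d ∈ n.divisors, (if Odd d then (1 : ZMod 2) else 0) =
          ∑ d ∈ (n / 2).divisors, if Odd d then (1 : ZMod 2) else 0 := by
        rw [← Finset.sum_filter, ← Finset.sum_filter]
        refine Finset.sum_congr ?_ fun _ _ => rfl
        obtain ⟨m, rfl⟩ := he.two_dvd
        rw [Nat.mul_div_cancel_left _ two_pos]
        ext d
        simp only [Finset.mem_filter, Nat.mem_divisors]
        constructor
        · rintro ⟨⟨h, -⟩, ho⟩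
          exact ⟨⟨(Nat.Coprime.dvd_mul_left (Nat.coprime_two_right.2 ho)).1 h, by omega⟩, ho⟩
        · rintro ⟨⟨h, h0⟩, ho⟩
          exact ⟨⟨h.mul_left 2, by omega⟩, ho⟩
      rw [this, ← two_mul, show (2 : ZMod 2) = 0 from rfl, zero_mul]
    · rintro ⟨m, rfl⟩
      have : Odd ((2 * m + 1) ^ 2) := Odd.pow ⟨m, rfl⟩
      exact (Nat.not_even_iff_odd.2 this) he
  · rw [if_neg (by rw [Nat.two_dvd_ne_zero]; exact Nat.odd_iff.1 ho), add_zero]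
    have : ∀ d ∈ n.divisors, (if Odd d then (1 : ZMod 2) else 0) = 1 := fun d hd =>
      if_pos (ho.of_dvd_nat (Nat.dvd_of_mem_divisors hd))
    rw [Finset.sum_congr rfl this, sum_divisors_one_zmod_two hn]
    congr 1
    refine propext ⟨?_, fun ⟨m, hm⟩ => ⟨2 * m + 1, hm⟩⟩
    rintro ⟨m, rfl⟩
    obtain ⟨t, rfl⟩ := (Nat.odd_pow_iff two_ne_zero).1 ho
    exact ⟨t, rfl⟩

end IntegralForms

/-! ### Integral forms reduce mod 2 to polynomials in Δ. -/

namespace IntegralForms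

open UpperHalfPlane ModularForm CongruenceSubgroup Matrix.SpecialLinearGroup
open scoped MatrixGroups ModularForm Manifold

open PowerSeries

/-- Δ is q times a unit of `ℤ⟦X⟧`, so division by Δ keeps coefficients integral. -/
theorem exists_mul_discSeries_eq (G : ℤ⟦X⟧) (h0 : coeff 0 G = 0) : ∃ H, discSeries * H = G := by
  have hd0 : coeff 0 discSeries = 0 := by
    have := congrArg (coeff 0) qExpansion_discriminant
    rw [coeff_map] at this
    have h2 := CuspFormClass.qExpansion_coeff_zero CuspForm.discriminant one_pos
      one_mem_strictPeriods_SL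
    rw [CuspForm.coe_discriminant, this, eq_intCast] at h2
    exact_mod_cast h2
  have hd1 : coeff 1 discSeries = 1 := by
    have := congrArg (coeff 1) qExpansion_discriminant
    rw [coeff_map, discriminant_qExpansion_coeff_one, eq_intCast] at this
    exact_mod_cast this.symm
  obtain ⟨u, hu⟩ := X_dvd_iff.2 ((coeff_zero_eq_constantCoeff_apply discSeries).symm.trans hd0)
  obtain ⟨v, hv⟩ := X_dvd_iff.2 ((coeff_zero_eq_constantCoeff_apply G).symm.trans h0)
  have hu1 : constantCoeff u = 1 := by
    rw [hu, show (1 : ℕ) = 0 + 1 from rfl, coeff_succ_X_mul,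
        coeff_zero_eq_constantCoeff_apply] at hd1
    exact hd1
  refine ⟨u.invOfUnit 1 * v, ?_⟩
  have := PowerSeries.mul_invOfUnit u 1 (by simpa using hu1)
  rw [hu, hv]
  linear_combination X * v * this

/-- The span of `1, Δ, …, Δ^k` over `F₂`. -/
noncomputable def spanDelta (k : ℕ) : Submodule (ZMod 2) (ZMod 2)⟦X⟧ :=
  Submodule.span (ZMod 2) {f | ∃ j ≤ k, f = Delta ^ j}

theorem pow_mem_spanDelta {j k : ℕ} (h : j ≤ k) : Delta ^ j ∈ spanDelta k :=
  Submodule.subset_span ⟨j, h, rfl⟩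

theorem delta_mul_mem_spanDelta {k : ℕ} {f : (ZMod 2)⟦X⟧} (hf : f ∈ spanDelta k) :
    Delta * f ∈ spanDelta (k + 1) := by
  induction hf using Submodule.span_induction with
  | mem x hx =>
    obtain ⟨j, hj, rfl⟩ := hx
    rw [← pow_succ']
    exact pow_mem_spanDelta (by omega)
  | zero => rw [mul_zero]; exact zero_mem _
  | add x y _ _ hx hy => rw [mul_add]; exact add_mem hx hy
  | smul c x _ hx => rw [mul_smul_comm]; exact Submodule.smul_mem _ c hx

theorem modTwo_C (a : ℤ) : modTwo (C a) = (a : ZMod 2) • (1 : (ZMod 2)⟦X⟧) := by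
  rw [PowerSeries.map_C, smul_eq_C_mul, mul_one]
  rfl

/-- A level one form of weight `12k` with integral Fourier coefficients reduces mod 2 to a
polynomial of degree at most `k` in `Δ`. -/
theorem modTwo_mem_spanDelta (k : ℕ) : ∀ (w : ℤ) (_ : w = 12 * k) (f : ModularForm 𝒮ℒ w) (G : ℤ⟦X⟧),
    qExpansion 1 f = toComplex G → modTwo G ∈ spanDelta k := by
  induction k with
  | zero =>
    rintro w hw f G hG
    obtain rfl : w = 0 := by simpa using hw
    obtain ⟨c, hc⟩ := ModularFormClass.levelOne_weight_zero_const f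
    have h1 : (f : ℍ → ℂ) = c • ⇑(1 : ModularForm 𝒮ℒ 0) := by rw [hc]; ext; simp
    rw [h1, ModularForm.qExpansion_smul one_pos one_mem_strictPeriods_SL,
      ModularForm.qExpansion_one] at hG
    have h2 : G = C (coeff 0 G) := by
      ext n
      have := congrArg (coeff n) hG
      rw [coeff_map, coeff_smul, coeff_one] at this
      rw [coeff_C]
      split_ifs at this ⊢ with hn
      · rw [hn]
      · simpa using this.symm
    rw [h2, modTwo_C]
    exact Submodule.smul_mem _ _ (by simpa using pow_mem_spanDelta (le_refl 0))
  | succ k ih =>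
    rintro w hw f G hG
    have hwt : ((3 * (k + 1) : ℕ) : ℤ) * 4 = w := by rw [hw]; push_cast; ring
    -- Subtracting a multiple of this power of E₄ kills the constant term; the difference is then Δ
    -- times a form of weight lower by 12 with integral coefficients. Mod 2 the subtracted form is a
    -- constant, since E₄ ≡ 1.
    set g : ModularForm 𝒮ℒ w := ModularForm.mcast hwt (E₄.pow (3 * (k + 1))) with hg
    set a : ℤ := coeff 0 G with ha
    set G₁ : ℤ⟦X⟧ := G - C a * (1 + 240 * sigmaSeries 3) ^ (3 * (k + 1)) with hG₁
    have h1 : qExpansion 1 (f - (a : ℂ) • g : ModularForm 𝒮ℒ w) = toComplex G₁ := by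
      have := ModularForm.qExpansion_sub one_pos one_mem_strictPeriods_SL f ((a : ℂ) • g)
      have h' := ModularForm.qExpansion_smul one_pos one_mem_strictPeriods_SL (a : ℂ) g
      rw [FunLike.coe_sub, this, FunLike.coe_smul, h', hg, ModularForm.qExpansion_mcast,
        ModularForm.qExpansion_pow one_pos one_mem_strictPeriods_SL, qExpansion_E₄, hG, hG₁,
        map_sub, map_mul, map_pow, smul_eq_C_mul, PowerSeries.map_C]
      rfl
    have h0 : coeff 0 G₁ = 0 := by
      simp [hG₁, ha, sigmaSeries]
    obtain ⟨H, hH⟩ := exists_mul_discSeries_eq G₁ h0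
    have h0' : (qExpansion 1 (f - (a : ℂ) • g : ModularForm 𝒮ℒ w)).coeff 0 = 0 := by
      rw [h1, coeff_map, h0, map_zero]
    have h2 := qExpansion_eq_qExpansion_discriminant_mul _ h0'
    rw [h1, ← hH, map_mul, qExpansion_discriminant] at h2
    have hne : toComplex discSeries ≠ 0 := by
      intro h
      have := congrArg (coeff 1) h
      rw [← qExpansion_discriminant, discriminant_qExpansion_coeff_one, map_zero] at this
      exact one_ne_zero this
    have h3 := ih (w - 12) (by rw [hw]; push_cast; ring) _ H (mul_left_cancel₀ hne h2).symm
    have h4 : modTwo G = (a : ZMod 2) • (1 : (ZMod 2)⟦X⟧) + Delta * modTwo H := by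
      rw [← modTwo_discSeries, ← map_mul, hH, hG₁, map_sub, map_mul, modTwo_C, map_pow,
        show (240 : ℤ⟦X⟧) = 2 * 120 by norm_num, map_add, map_mul, map_mul, modTwo_two]
      simp
    rw [h4]
    refine add_mem (Submodule.smul_mem _ _ ?_) (delta_mul_mem_spanDelta h3)
    simpa using pow_mem_spanDelta (Nat.zero_le (k + 1))

/-- The Hecke operators preserve polynomials of bounded degree in `Δ`. -/
theorem heckeOp_delta_pow_mem {p : ℕ} (hp : p.Prime) (hp2 : p ≠ 2) {k : ℕ} (hk : k ≠ 0) :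
    heckeOp p (Delta ^ k) ∈ spanDelta k := by
  have : Fact p.Prime := ⟨hp⟩
  set f : ModularForm 𝒮ℒ (k * 12) :=
    (CuspForm.discriminant : ModularForm 𝒮ℒ 12).pow k with hf
  have hfq : qExpansion 1 f = toComplex (discSeries ^ k) := by
    rw [hf, ModularForm.qExpansion_pow one_pos one_mem_strictPeriods_SL, map_pow,
      ← qExpansion_discriminant]
    rfl
  -- The integral expansion of T_p Δ^k. The factor p^(12k-1) is 1 mod 2, so the reduction is given
  -- by `heckeOp`.
  set G : ℤ⟦X⟧ := PowerSeries.mk fun n => coeff (p * n) (discSeries ^ k) +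
    (p : ℤ) ^ (k * 12 - 1) * if p ∣ n then coeff (n / p) (discSeries ^ k) else 0 with hG
  have hq : qExpansion 1 (LevelOneHecke.hecke p f) = toComplex G := by
    ext n
    rw [LevelOneHecke.coeff_qExpansion_hecke, hfq, coeff_map, coeff_map, coeff_map, hG, coeff_mk,
      show (k : ℤ) * 12 - 1 = ((k * 12 - 1 : ℕ) : ℤ) by omega, zpow_natCast]
    split_ifs <;> simp
  have h := modTwo_mem_spanDelta k (k * 12) (by ring) _ G hq
  convert h using 1
  ext n
  have h2 : Delta ^ k = modTwo (discSeries ^ k) := by rw [map_pow, modTwo_discSeries]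
  have hp1 : ((p : ℤ) : ZMod 2) = 1 := by
    have := (ZMod.natCast_eq_one_iff_odd).2 (hp.odd_of_ne_two hp2)
    exact_mod_cast this
  rw [coeff_map, hG, coeff_mk]
  simp only [heckeOp, LinearMap.coe_mk, AddHom.coe_mk, coeff_mk, h2, coeff_map, eq_intCast]
  push_cast
  push_cast at hp1
  rw [hp1]
  split_ifs <;> simp

end IntegralForms

/-! ### Exponents mod 8 and formal properties of the mod 2 Hecke operators. -/

namespace HeckeModTwo

open PowerSeries

theorem coeff_heckeOp (p n : ℕ) (f : (ZMod 2)⟦X⟧) :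
    coeff n (heckeOp p f) = coeff (p * n) f + if p ∣ n then coeff (n / p) f else 0 := by
  simp [heckeOp]

/-- The series has all its exponents congruent to `r` mod `8`. -/
def HasResidue (r : ZMod 8) (f : (ZMod 2)⟦X⟧) : Prop := ∀ n, coeff n f ≠ 0 → (n : ZMod 8) = r

theorem HasResidue.mul {r s : ZMod 8} {f g : (ZMod 2)⟦X⟧} (hf : HasResidue r f)
    (hg : HasResidue s g) : HasResidue (r + s) (f * g) := by
  intro n hn
  rw [coeff_mul] at hn
  obtain ⟨⟨i, j⟩, hij, h⟩ := Finset.exists_ne_zero_of_sum_ne_zero hn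
  rw [← hf i (left_ne_zero_of_mul h), ← hg j (right_ne_zero_of_mul h),
    ← Finset.HasAntidiagonal.mem_antidiagonal.1 hij]
  push_cast
  rfl

theorem hasResidue_delta : HasResidue 1 Delta := by
  classical
  intro n hn
  rw [Delta, coeff_mk] at hn
  obtain ⟨m, rfl⟩ : ∃ m : ℕ, n = (2 * m + 1) ^ 2 := by
    by_contra h
    exact hn (if_neg h)
  push_cast
  generalize (m : ZMod 8) = x
  revert x
  decide

theorem hasResidue_delta_pow (k : ℕ) : HasResidue k (Delta ^ k) := by
  induction k with
  | zero =>
    intro n hn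
    rw [pow_zero, coeff_one] at hn
    have : n = 0 := by
      by_contra h
      exact hn (if_neg h)
    rw [this]
  | succ k ih =>
    rw [pow_succ]
    push_cast
    exact ih.mul hasResidue_delta

theorem odd_mul_self {p : ℕ} (hp : Odd p) : (p : ZMod 8) * p = 1 := by
  obtain ⟨m, rfl⟩ := hp
  push_cast
  generalize (m : ZMod 8) = x
  revert x
  decide

/-- Since p is its own inverse mod 8, both n ↦ n/p and n ↦ pn multiply the residue by p. -/
theorem HasResidue.heckeOp {r : ZMod 8} {f : (ZMod 2)⟦X⟧} (hf : HasResidue r f) {p : ℕ}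
    (hp : Odd p) : HasResidue (p * r) (heckeOp p f) := by
  intro n hn
  rw [coeff_heckeOp] at hn
  by_cases h1 : coeff (p * n) f = 0
  · rw [h1, zero_add] at hn
    split_ifs at hn with h2
    · obtain ⟨m, rfl⟩ := h2
      rw [Nat.mul_div_cancel_left _ hp.pos] at hn
      rw [← hf m hn]
      push_cast
      rfl
    · exact absurd rfl hn
  · rw [← hf _ h1]
    push_cast
    rw [← mul_assoc, odd_mul_self hp, one_mul]

/-- Projection onto the exponents congruent to `r` mod `8`. -/
noncomputable def residueProj (r : ZMod 8) : (ZMod 2)⟦X⟧ →ₗ[ZMod 2] (ZMod 2)⟦X⟧ where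
  toFun f := PowerSeries.mk fun n => if (n : ZMod 8) = r then coeff n f else 0
  map_add' f g := by
    ext n
    simp only [coeff_mk, map_add]
    split_ifs <;> simp
  map_smul' c f := by
    ext n
    simp only [coeff_mk, map_smul, RingHom.id_apply]
    split_ifs <;> simp

theorem HasResidue.residueProj_eq {r : ZMod 8} {f : (ZMod 2)⟦X⟧} (hf : HasResidue r f) :
    residueProj r f = f := by
  ext n
  simp only [residueProj, LinearMap.coe_mk, AddHom.coe_mk, coeff_mk]
  split_ifs with h
  · rfl
  · by_contra h'
    exact h (hf n (Ne.symm h'))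

theorem HasResidue.residueProj_of_ne {r s : ZMod 8} {f : (ZMod 2)⟦X⟧} (hf : HasResidue r f)
    (hrs : r ≠ s) : residueProj s f = 0 := by
  ext n
  simp only [residueProj, LinearMap.coe_mk, AddHom.coe_mk, coeff_mk, map_zero]
  split_ifs with h
  · by_contra h'
    exact hrs ((hf n h').symm.trans h)
  · rfl

/-- `T_p Δ^k` is a combination of the `Δ^j` with `j ≤ k` and `j ≡ pk` mod `8`. -/
theorem heckeOp_delta_pow_mem_span {p : ℕ} (hp : p.Prime) (hp2 : p ≠ 2) {k : ℕ} (hk : k ≠ 0) :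
    heckeOp p (Delta ^ k) ∈ Submodule.span (ZMod 2)
      {f | ∃ j ≤ k, (j : ZMod 8) = p * k ∧ f = Delta ^ j} := by
  have h1 := IntegralForms.heckeOp_delta_pow_mem hp hp2 hk
  have h2 := (hasResidue_delta_pow k).heckeOp (hp.odd_of_ne_two hp2)
  -- Projection to the class of pk fixes T_p Δ^k, and it kills each Δ^j outside that class.
  rw [← h2.residueProj_eq]
  generalize heckeOp p (Delta ^ k) = g at h1
  induction h1 using Submodule.span_induction with
  | mem x hx =>
    obtain ⟨j, hj, rfl⟩ := hx
    by_cases hr : (j : ZMod 8) = p * k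
    · have := (hasResidue_delta_pow j).residueProj_eq
      rw [hr] at this
      rw [this]
      exact Submodule.subset_span ⟨j, hj, hr, rfl⟩
    · rw [(hasResidue_delta_pow j).residueProj_of_ne hr]
      exact zero_mem _
  | zero => rw [map_zero]; exact zero_mem _
  | add x y _ _ hx hy => rw [map_add]; exact add_mem hx hy
  | smul c x _ hx => rw [map_smul]; exact Submodule.smul_mem _ c hx

/-- For k odd, the exponents j ≡ pk mod 8 are odd as well, and j ≤ k. -/
theorem heckeOp_mem_spaceF {p : ℕ} (hp : p.Prime) (hp2 : p ≠ 2) {n : ℕ} {f : (ZMod 2)⟦X⟧}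
    (hf : f ∈ spaceF n) : heckeOp p f ∈ spaceF n := by
  induction hf using Submodule.span_induction with
  | mem x hx =>
    obtain ⟨i, hi, rfl⟩ := hx
    refine Submodule.span_mono ?_ (heckeOp_delta_pow_mem_span hp hp2 (Nat.succ_ne_zero (2 * i)))
    rintro f ⟨j, hj, hr, rfl⟩
    have hodd : Odd j := by
      have ho : Odd (p * (2 * i + 1)) := (hp.odd_of_ne_two hp2).mul ⟨i, rfl⟩
      have : j ≡ p * (2 * i + 1) [MOD 8] :=
        (ZMod.natCast_eq_natCast_iff _ _ _).1 (by rw [hr]; push_cast; rfl)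
      rw [Nat.odd_iff] at ho ⊢
      have := this.of_dvd (show 2 ∣ 8 by norm_num)
      rw [Nat.ModEq] at this
      omega
    obtain ⟨m, rfl⟩ := hodd
    exact ⟨m, by omega, rfl⟩
  | zero => rw [map_zero]; exact zero_mem _
  | add x y _ _ hx hy => rw [map_add]; exact add_mem hx hy
  | smul c x _ hx => rw [map_smul]; exact Submodule.smul_mem _ c hx

/-- Squaring is q ↦ q², which commutes with T_p because p is odd. -/
theorem heckeOp_sq {p : ℕ} (hp : Odd p) (f : (ZMod 2)⟦X⟧) :
    heckeOp p (f ^ 2) = heckeOp p f ^ 2 := by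
  ext n
  have h2p : Nat.Coprime 2 p := Nat.coprime_two_left.2 hp
  rw [coeff_heckeOp, coeff_sq_zmod_two, coeff_sq_zmod_two, coeff_sq_zmod_two, coeff_heckeOp]
  by_cases hn : 2 ∣ n
  · obtain ⟨m, rfl⟩ := hn
    have e1 : 2 ∣ p * (2 * m) := ⟨p * m, by ring⟩
    have e2 : p * (2 * m) / 2 = p * m := by
      rw [show p * (2 * m) = 2 * (p * m) by ring, Nat.mul_div_cancel_left _ two_pos]
    have e3 : p ∣ 2 * m ↔ p ∣ m := h2p.symm.dvd_mul_left
    rw [if_pos e1, e2, if_pos (dvd_mul_right 2 m), Nat.mul_div_cancel_left _ two_pos]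
    simp only [e3]
    congr 1
    split_ifs with h3 h4
    · obtain ⟨l, rfl⟩ := h3
      rw [show 2 * (p * l) = p * (2 * l) by ring, Nat.mul_div_cancel_left _ hp.pos,
        Nat.mul_div_cancel_left _ two_pos, Nat.mul_div_cancel_left _ hp.pos]
    · obtain ⟨l, rfl⟩ := h3
      rw [show 2 * (p * l) = p * (2 * l) by ring, Nat.mul_div_cancel_left _ hp.pos] at h4
      exact absurd (dvd_mul_right 2 l) h4
    · rfl
  · rw [if_neg hn, if_neg (by rwa [h2p.dvd_mul_left])]
    split_ifs with h3 h4
    · obtain ⟨l, rfl⟩ := h3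
      rw [Nat.mul_div_cancel_left _ hp.pos] at h4
      exact absurd (h4.mul_left p) hn
    · rw [add_zero]
    · rw [add_zero]

theorem heckeOp_comm {p q : ℕ} (hp : 0 < p) (hq : 0 < q) (h : p.Coprime q) (f : (ZMod 2)⟦X⟧) :
    heckeOp p (heckeOp q f) = heckeOp q (heckeOp p f) := by
  ext n
  simp only [coeff_heckeOp, h.dvd_mul_left, h.symm.dvd_mul_left, mul_left_comm p q n]
  by_cases hpn : p ∣ n
  · obtain ⟨m, rfl⟩ := hpn
    rw [if_pos (dvd_mul_right p m), if_pos (dvd_mul_right p m), Nat.mul_div_cancel_left _ hp,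
      show q * (p * m) / p = q * m by rw [mul_left_comm, Nat.mul_div_cancel_left _ hp]]
    simp only [h.symm.dvd_mul_left]
    by_cases hqm : q ∣ m
    · obtain ⟨l, rfl⟩ := hqm
      rw [if_pos (dvd_mul_right q l), if_pos (dvd_mul_right q l), if_pos (dvd_mul_right q l),
        Nat.mul_div_cancel_left _ hq,
        show p * (p * (q * l)) / q = p * (p * l) by
          rw [show p * (p * (q * l)) = q * (p * (p * l)) by ring, Nat.mul_div_cancel_left _ hq],
        show p * (q * l) / q = p * l by rw [mul_left_comm, Nat.mul_div_cancel_left _ hq],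
        if_pos (dvd_mul_right p l), Nat.mul_div_cancel_left _ hp]
      ring
    · simp only [if_neg hqm]
      ring
  · simp only [if_neg hpn]
    by_cases hqn : q ∣ n
    · obtain ⟨l, rfl⟩ := hqn
      rw [if_pos (dvd_mul_right q l), if_pos (dvd_mul_right q l), Nat.mul_div_cancel_left _ hq,
        show p * (q * l) / q = p * l by rw [mul_left_comm, Nat.mul_div_cancel_left _ hq],
        if_neg fun hl => hpn (hl.mul_left q)]
      ring
    · simp only [if_neg hqn]

end HeckeModTwo

/-! ### Traces, and recursions from symmetric relations. -/

namespace HeckeModTwo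

open PowerSeries

/-- The operator `∑ a_n q^n ↦ ∑ a_{pn} q^n`. -/
noncomputable def opU (p : ℕ) : (ZMod 2)⟦X⟧ →ₗ[ZMod 2] (ZMod 2)⟦X⟧ where
  toFun f := PowerSeries.mk fun n => coeff (p * n) f
  map_add' f g := by ext n; simp
  map_smul' c f := by ext n; simp

theorem coeff_opU (p n : ℕ) (f : (ZMod 2)⟦X⟧) : coeff n (opU p f) = coeff (p * n) f := by
  simp [opU]

theorem heckeOp_eq {p : ℕ} (hp : p ≠ 0) (f : (ZMod 2)⟦X⟧) :
    heckeOp p f = opU p f + expand p hp f := by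
  ext n
  rw [coeff_heckeOp, map_add, coeff_opU, coeff_expand]

/-- Projection formula: in an exponent divisible by p, the terms of g(q^p) only meet terms of f with
exponent divisible by p. -/
theorem opU_mul_expand {p : ℕ} (hp : p ≠ 0) (f g : (ZMod 2)⟦X⟧) :
    opU p (f * expand p hp g) = opU p f * g := by
  ext n
  rw [coeff_opU, coeff_mul, coeff_mul]
  symm
  have hp' : 0 < p := Nat.pos_of_ne_zero hp
  refine Finset.sum_of_injOn (fun x => (p * x.1, p * x.2)) ?_ ?_ ?_ ?_
  · rintro ⟨a, b⟩ - ⟨c, d⟩ - h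
    simp only [Prod.mk.injEq] at h
    exact Prod.ext (Nat.eq_of_mul_eq_mul_left hp' h.1) (Nat.eq_of_mul_eq_mul_left hp' h.2)
  · rintro ⟨a, b⟩ h
    simp only [Finset.mem_coe, Finset.HasAntidiagonal.mem_antidiagonal] at h ⊢
    rw [← h, mul_add]
  · rintro ⟨a, b⟩ h h'
    rw [Finset.HasAntidiagonal.mem_antidiagonal] at h
    by_cases hb : p ∣ b
    · exfalso
      obtain ⟨d, rfl⟩ := hb
      obtain ⟨c, rfl⟩ : p ∣ a := (Nat.dvd_add_left (dvd_mul_right p d)).1 (h ▸ dvd_mul_right p n)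
      refine h' ⟨(c, d), ?_, rfl⟩
      simp only [Finset.mem_coe, Finset.HasAntidiagonal.mem_antidiagonal]
      simp only at h
      rw [← mul_add] at h
      exact Nat.eq_of_mul_eq_mul_left hp' h
    · rw [coeff_expand_of_not_dvd p hp _ hb, mul_zero]
  · rintro ⟨a, b⟩ -
    rw [coeff_opU, coeff_expand_mul]

/-- `Δ(q)/q`. -/
noncomputable def deltaUnit : (ZMod 2)⟦X⟧ := PowerSeries.mk fun n => coeff (n + 1) Delta

theorem delta_eq : Delta = X * deltaUnit := by
  ext n
  rcases n with - | n
  · rw [Delta, coeff_mk, if_neg]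
    · simp
    · rintro ⟨m, hm⟩
      exact (pow_pos (Nat.succ_pos (2 * m)) 2).ne hm
  · rw [coeff_succ_X_mul, deltaUnit, coeff_mk]

/-- The odd squares 1, 9, 25, shifted by one. -/
theorem deltaUnit_eq : ∃ g, deltaUnit = 1 + X ^ 8 + X ^ 24 * g := by
  classical
  refine ⟨PowerSeries.mk fun n => coeff (n + 24) deltaUnit, ?_⟩
  ext n
  by_cases hn : n < 24
  · have h1 : coeff n (X ^ 24 * (PowerSeries.mk fun n => coeff (n + 24) deltaUnit)) = 0 := by
      rw [coeff_X_pow_mul', if_neg (by omega)]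
    rw [map_add, map_add, h1, coeff_one, coeff_X_pow, deltaUnit, coeff_mk, Delta, coeff_mk,
        add_zero]
    by_cases h0 : n = 0
    · subst h0
      rw [if_pos ⟨0, rfl⟩]
      simp
    by_cases h8 : n = 8
    · subst h8
      rw [if_pos ⟨1, rfl⟩]
      simp
    rw [if_neg, if_neg h0, if_neg h8, add_zero]
    rintro ⟨m, hm⟩
    have : m < 3 := by nlinarith
    interval_cases m <;> omega
  · have e : n = (n - 24) + 24 := by omega
    rw [map_add, map_add, coeff_X_pow_mul', if_pos (by omega), coeff_mk, ← e, coeff_one,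
        coeff_X_pow,
      if_neg (by omega), if_neg (by omega), zero_add, zero_add]

theorem constantCoeff_deltaUnit : constantCoeff deltaUnit = 1 := by
  obtain ⟨g, hg⟩ := deltaUnit_eq
  rw [hg]
  simp

theorem delta_pow_eq (k : ℕ) : Delta ^ k = X ^ k * deltaUnit ^ k := by
  rw [delta_eq, mul_pow]

theorem coeff_self_delta_pow (k : ℕ) : coeff k (Delta ^ k) = 1 := by
  rw [delta_pow_eq, coeff_X_pow_mul', if_pos le_rfl, Nat.sub_self,
      coeff_zero_eq_constantCoeff_apply,
    map_pow, constantCoeff_deltaUnit, one_pow]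

theorem coeff_delta_pow (k n : ℕ) (hn : n < 24) :
    coeff (n + k) (Delta ^ k) = coeff n ((1 + X ^ 8 : (ZMod 2)⟦X⟧) ^ k) := by
  obtain ⟨g, hg⟩ := deltaUnit_eq
  rw [delta_pow_eq, coeff_X_pow_mul]
  obtain ⟨h, hh⟩ := sub_dvd_pow_sub_pow deltaUnit (1 + X ^ 8) k
  rw [← sub_eq_zero, ← map_sub, hh, hg, add_sub_cancel_left, mul_assoc, coeff_X_pow_mul',
    if_neg (by omega)]

/-- If the trace of `G Δ^j` vanishes for all `j < p`, then `G = 0`. -/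
theorem eq_zero_of_trace_eq_zero {p : ℕ} (hp : 1 < p) {G : (ZMod 2)⟦X⟧}
    (h0 : constantCoeff G = 0)
    (h : ∀ j < p, G * expand p (by omega) Delta ^ j + opU p (G * Delta ^ j) = 0) : G = 0 := by
  by_contra hG
  have hp0 : p ≠ 0 := by omega
  set v := G.order.toNat with hv
  have hvo : (v : ℕ∞) = G.order := ENat.natCast_toNat (fun hh => hG (order_eq_top.1 hh))
  obtain ⟨G', hG'⟩ : X ^ v ∣ G := X_pow_dvd_iff.2 fun m hm => coeff_of_lt_order m (by
    rw [← hvo]; exact_mod_cast hm)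
  have hc : constantCoeff G' ≠ 0 := by
    have := coeff_order hG
    rw [← hv, hG', coeff_X_pow_mul', if_pos le_rfl, Nat.sub_self,
      coeff_zero_eq_constantCoeff_apply] at this
    exact this
  have hv1 : 1 ≤ v := by
    by_contra hlt
    have hv0 : v = 0 := by omega
    rw [hG', hv0, pow_zero, one_mul] at h0
    exact hc h0
  -- With p dividing v + j, the lowest term of G Δ^j survives in `opU` at exponent m = (v+j)/p,
  -- whereas G Δ(q^p)^j only starts at v + pj > m. The trace is then nonzero.
  obtain ⟨j, hj, m, hm⟩ : ∃ j < p, ∃ m, v + j = p * m := by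
    rcases Nat.eq_zero_or_pos (v % p) with h' | h'
    · exact ⟨0, by omega, v / p,
        by rw [add_zero]; exact (Nat.mul_div_cancel' (Nat.dvd_of_mod_eq_zero h')).symm⟩
    · refine ⟨p - v % p, by omega, v / p + 1, ?_⟩
      have := Nat.div_add_mod v p
      have := Nat.mod_lt v (show 0 < p by omega)
      rw [mul_add]
      omega
  have h1 : coeff m (opU p (G * Delta ^ j)) = constantCoeff G' := by
    rw [coeff_opU, ← hm, hG', delta_pow_eq, mul_mul_mul_comm, ← pow_add, coeff_X_pow_mul',
      if_pos le_rfl, Nat.sub_self, coeff_zero_eq_constantCoeff_apply, map_mul, map_pow,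
      constantCoeff_deltaUnit, one_pow, mul_one]
  have hlt : m < v + p * j := by
    rcases Nat.eq_zero_or_pos j with rfl | hj0
    · rw [add_zero] at hm
      have hm0 : 0 < m := Nat.pos_of_ne_zero (by rintro rfl; omega)
      nlinarith
    · have : m ≤ v := by nlinarith
      have := Nat.mul_pos (show 0 < p by omega) hj0
      omega
  have h2 : coeff m (G * expand p hp0 Delta ^ j) = 0 := by
    rw [hG', delta_eq, map_mul (expand p hp0), expand_X, mul_pow, ← pow_mul, mul_mul_mul_comm,
        ← pow_add,
      coeff_X_pow_mul', if_neg (by omega)]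
  have h3 := congrArg (coeff m) (h j hj)
  rw [map_add, h1, h2, zero_add, map_zero] at h3
  exact hc h3

/-- A symmetric relation between `Δ(q)` and `Δ(q^p)` yields a recursion for `T_p Δ^k`. -/
theorem heckeOp_delta_pow_add {p : ℕ} (hp : p ≠ 0) {n A : ℕ} (a b : Fin n → ℕ)
    (h1 : expand p hp Delta ^ A = ∑ i, expand p hp Delta ^ a i * Delta ^ b i)
    (h2 : Delta ^ A = ∑ i, Delta ^ a i * expand p hp Delta ^ b i) (r : ℕ) :
    heckeOp p (Delta ^ (A + r)) = ∑ i, Delta ^ b i * heckeOp p (Delta ^ (a i + r)) := by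
  -- T_p is the sum of `opU p` and q ↦ q^p. The projection formula needs the relation solved for
  -- Δ(q)^A, the other part needs it solved for Δ(q^p)^A; symmetry makes the two recursions agree.
  have h3 : opU p (Delta ^ (A + r)) = ∑ i, Delta ^ b i * opU p (Delta ^ (a i + r)) := by
    rw [pow_add, h2, Finset.sum_mul, map_sum]
    refine Finset.sum_congr rfl fun i _ => ?_
    rw [mul_right_comm, ← pow_add, ← map_pow, opU_mul_expand, mul_comm]
  have h4 : expand p hp (Delta ^ (A + r)) =
      ∑ i, Delta ^ b i * expand p hp (Delta ^ (a i + r)) := by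
    rw [map_pow, pow_add, h1, Finset.sum_mul]
    refine Finset.sum_congr rfl fun i _ => ?_
    rw [map_pow, pow_add]
    ring
  rw [heckeOp_eq hp, h3, h4, ← Finset.sum_add_distrib]
  refine Finset.sum_congr rfl fun i _ => ?_
  rw [heckeOp_eq hp, mul_add]

/-- The trace of `∑ Δ^{a_i} Δ(q^p)^{b_i}` times `Δ^j`. -/
theorem trace_eq {p : ℕ} (hp : p ≠ 0) {n : ℕ} (a b : Fin n → ℕ)
    (G : (ZMod 2)⟦X⟧) (h1 : G = ∑ i, expand p hp Delta ^ a i * Delta ^ b i)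
    (h2 : G = ∑ i, Delta ^ a i * expand p hp Delta ^ b i) (j : ℕ) :
    G * expand p hp Delta ^ j + opU p (G * Delta ^ j) =
      ∑ i, Delta ^ b i * heckeOp p (Delta ^ (a i + j)) := by
  have h3 : opU p (G * Delta ^ j) = ∑ i, Delta ^ b i * opU p (Delta ^ (a i + j)) := by
    rw [h2, Finset.sum_mul, map_sum]
    refine Finset.sum_congr rfl fun i _ => ?_
    rw [mul_right_comm, ← pow_add, ← map_pow, opU_mul_expand, mul_comm]
  rw [h3, h1, Finset.sum_mul, ← Finset.sum_add_distrib]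
  refine Finset.sum_congr rfl fun i _ => ?_
  rw [heckeOp_eq hp, map_pow (expand p hp), pow_add (expand p hp Delta)]
  ring

end HeckeModTwo

/-! ### Small values of `T_3` and `T_5`, and the modular equations. -/

namespace HeckeModTwo

open PowerSeries

theorem two_eq_zero : (2 : (ZMod 2)⟦X⟧) = 0 := by
  rw [show (2 : (ZMod 2)⟦X⟧) = C 2 from rfl, show (2 : ZMod 2) = 0 from rfl, map_zero]

theorem heckeOp_one {p : ℕ} (hp : p ≠ 0) : heckeOp p (1 : (ZMod 2)⟦X⟧) = 0 := by
  ext n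
  rw [coeff_heckeOp, coeff_one, coeff_one, map_zero]
  rcases eq_or_ne n 0 with rfl | hn
  · simp
    rfl
  · rw [if_neg (mul_ne_zero hp hn), zero_add]
    split_ifs with h1 h2
    · exact absurd (Nat.eq_zero_of_dvd_of_div_eq_zero h1 h2) hn
    · rfl
    · rfl

/-- When only one j₀ ≤ k lies in the class of pk, T_p Δ^k is a multiple of Δ^j₀, and the factor is
read off at q^j₀, where Δ^j₀ has leading coefficient 1. -/
theorem heckeOp_delta_pow_eq {p : ℕ} (hp : p.Prime) (hp2 : p ≠ 2) {k : ℕ} (hk : k ≠ 0) (j₀ : ℕ)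
    (h : ∀ j ≤ k, (j : ZMod 8) = p * k → j = j₀) :
    heckeOp p (Delta ^ k) = (coeff (p * j₀) (Delta ^ k) +
      if p ∣ j₀ then coeff (j₀ / p) (Delta ^ k) else 0) • Delta ^ j₀ := by
  have h1 := heckeOp_delta_pow_mem_span hp hp2 hk
  have h2 : heckeOp p (Delta ^ k) ∈ Submodule.span (ZMod 2) {Delta ^ j₀} := by
    refine Submodule.span_mono ?_ h1
    rintro f ⟨j, hj, hr, rfl⟩
    rw [h j hj hr]
    rfl
  obtain ⟨c, hc⟩ := Submodule.mem_span_singleton.1 h2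
  have h3 := congrArg (coeff j₀) hc
  rw [coeff_smul, coeff_self_delta_pow, smul_eq_mul, mul_one, coeff_heckeOp] at h3
  rw [← h3, hc]

theorem heckeOp_delta_pow_eq_zero {p : ℕ} (hp : p.Prime) (hp2 : p ≠ 2) {k : ℕ} (hk : k ≠ 0)
    (h : ∀ j ≤ k, (j : ZMod 8) ≠ p * k) : heckeOp p (Delta ^ k) = 0 := by
  have h1 := heckeOp_delta_pow_mem_span hp hp2 hk
  rw [← Submodule.mem_bot (ZMod 2), ← Submodule.span_empty (R := ZMod 2)]
  refine Submodule.span_mono ?_ h1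
  rintro f ⟨j, hj, hr, rfl⟩
  exact absurd hr (h j hj)

theorem heckeOp_delta_pow_two_mul {p : ℕ} (hp : Odd p) {k : ℕ} :
    heckeOp p (Delta ^ (2 * k)) = heckeOp p (Delta ^ k) ^ 2 := by
  rw [mul_comm, pow_mul, heckeOp_sq hp]

theorem one_add_X_pow_sq (n : ℕ) : (1 + X ^ n : (ZMod 2)⟦X⟧) ^ 2 = 1 + X ^ (2 * n) := by
  linear_combination (X ^ n : (ZMod 2)⟦X⟧) * two_eq_zero

theorem heckeThree_one : heckeOp 3 Delta = 0 := by
  simpa using heckeOp_delta_pow_eq_zero Nat.prime_three (by norm_num) one_ne_zero (by decide)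

theorem heckeThree_two : heckeOp 3 (Delta ^ 2) = 0 := by
  rw [heckeOp_sq (by decide), heckeThree_one]; ring

theorem heckeThree_three : heckeOp 3 (Delta ^ 3) = Delta := by
  rw [heckeOp_delta_pow_eq Nat.prime_three (by norm_num) three_ne_zero 1 (by decide), mul_one,
    coeff_self_delta_pow]
  simp

theorem heckeThree_four : heckeOp 3 (Delta ^ 4) = 0 := by
  rw [show 4 = 2 * 2 from rfl, heckeOp_delta_pow_two_mul (by decide), heckeThree_two]; ring

theorem heckeThree_five : heckeOp 3 (Delta ^ 5) = 0 :=
  heckeOp_delta_pow_eq_zero Nat.prime_three (by norm_num) (by norm_num) (by decide)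

theorem heckeThree_six : heckeOp 3 (Delta ^ 6) = Delta ^ 2 := by
  rw [show 6 = 2 * 3 from rfl, heckeOp_delta_pow_two_mul (by decide), heckeThree_three]

theorem heckeFive_one : heckeOp 5 Delta = 0 := by
  simpa using heckeOp_delta_pow_eq_zero Nat.prime_five (by norm_num) one_ne_zero (by decide)

theorem heckeFive_two : heckeOp 5 (Delta ^ 2) = 0 := by
  rw [heckeOp_sq (by decide), heckeFive_one]; ring

theorem heckeFive_three : heckeOp 5 (Delta ^ 3) = 0 :=
  heckeOp_delta_pow_eq_zero Nat.prime_five (by norm_num) three_ne_zero (by decide)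

theorem heckeFive_four : heckeOp 5 (Delta ^ 4) = 0 := by
  rw [show 4 = 2 * 2 from rfl, heckeOp_delta_pow_two_mul (by decide), heckeFive_two]; ring

theorem heckeFive_five : heckeOp 5 (Delta ^ 5) = Delta := by
  rw [heckeOp_delta_pow_eq Nat.prime_five (by norm_num) (by norm_num) 1 (by decide), mul_one,
    coeff_self_delta_pow]
  simp

theorem heckeFive_six : heckeOp 5 (Delta ^ 6) = 0 := by
  rw [show 6 = 2 * 3 from rfl, heckeOp_delta_pow_two_mul (by decide), heckeFive_three]; ring

theorem heckeFive_seven : heckeOp 5 (Delta ^ 7) = Delta ^ 3 := by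
  rw [heckeOp_delta_pow_eq Nat.prime_five (by norm_num) (by norm_num) 3 (by decide),
    if_neg (by norm_num), add_zero, show 5 * 3 = 8 + 7 from rfl, coeff_delta_pow 7 8 (by norm_num)]
  have : (1 + X ^ 8 : (ZMod 2)⟦X⟧) ^ 7 = 1 + X ^ 8 + X ^ 16 * (1 + X ^ 8) * (1 + X ^ 32 + X ^ 16) :=
      by
    rw [show 7 = 2 * 2 + 2 + 1 from rfl, pow_succ, pow_add, pow_mul, one_add_X_pow_sq,
      one_add_X_pow_sq]
    ring
  rw [this, map_add, map_add, mul_assoc, coeff_X_pow_mul']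
  simp [coeff_one, coeff_X_pow]

theorem heckeFive_eight : heckeOp 5 (Delta ^ 8) = 0 := by
  rw [show 8 = 2 * 4 from rfl, heckeOp_delta_pow_two_mul (by decide), heckeFive_four]; ring

theorem heckeFive_nine : heckeOp 5 (Delta ^ 9) = 0 := by
  rw [heckeOp_delta_pow_eq Nat.prime_five (by norm_num) (by norm_num) 5 (by decide),
    show 5 * 5 = 16 + 9 from rfl, coeff_delta_pow 9 16 (by norm_num)]
  have : (1 + X ^ 8 : (ZMod 2)⟦X⟧) ^ 9 = 1 + X ^ 8 + X ^ 64 * (1 + X ^ 8) := by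
    rw [show 9 = 2 * 2 * 2 + 1 from rfl, pow_succ, pow_mul, pow_mul, one_add_X_pow_sq,
      one_add_X_pow_sq, one_add_X_pow_sq]
    ring
  rw [this, map_add, map_add, coeff_X_pow_mul', delta_pow_eq, coeff_X_pow_mul']
  simp [coeff_one, coeff_X_pow]

theorem heckeFive_ten : heckeOp 5 (Delta ^ 10) = Delta ^ 2 := by
  rw [show 10 = 2 * 5 from rfl, heckeOp_delta_pow_two_mul (by decide), heckeFive_five]

theorem constantCoeff_delta : constantCoeff Delta = 0 := by
  rw [delta_eq]
  simp

/-- The modular equation between `Δ(q)` and `Δ(q³)`. -/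
theorem modularEquation_three :
    expand 3 three_ne_zero Delta ^ 4 + expand 3 three_ne_zero Delta * Delta + Delta ^ 4 = 0 := by
  -- The traces for j < 3 involve T_3 Δ^k only for k ≤ 6, and these values are already known from
  -- degree and residue. For p = 5 the same holds with k ≤ 10.
  refine eq_zero_of_trace_eq_zero (p := 3) (by norm_num) ?_ fun j hj => ?_
  · simp [constantCoeff_delta]
  · rw [trace_eq three_ne_zero ![4, 1, 0] ![0, 1, 4]]
    · interval_cases j <;>
        simp [Fin.sum_univ_succ, heckeThree_one, heckeThree_two, heckeThree_three, heckeThree_four,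
          heckeThree_five, heckeThree_six, heckeOp_one]
      linear_combination Delta ^ 2 * two_eq_zero
    · simp [Fin.sum_univ_succ]; ring
    · simp [Fin.sum_univ_succ]; ring

/-- The modular equation between `Δ(q)` and `Δ(q⁵)`. -/
theorem modularEquation_five :
    expand 5 (by norm_num) Delta ^ 6 + expand 5 (by norm_num) Delta ^ 4 * Delta ^ 2 +
      expand 5 (by norm_num) Delta ^ 2 * Delta ^ 4 + expand 5 (by norm_num) Delta * Delta +
      Delta ^ 6 = 0 := by
  refine eq_zero_of_trace_eq_zero (p := 5) (by norm_num) ?_ fun j hj => ?_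
  · simp [constantCoeff_delta]
  · rw [trace_eq (by norm_num) ![6, 4, 2, 1, 0] ![0, 2, 4, 1, 6]]
    · interval_cases j <;>
        simp [Fin.sum_univ_succ, heckeFive_one, heckeFive_two, heckeFive_three, heckeFive_four,
          heckeFive_five, heckeFive_six, heckeFive_seven, heckeFive_eight, heckeFive_nine,
          heckeFive_ten, heckeOp_one]
      · linear_combination Delta ^ 3 * two_eq_zero
      · linear_combination Delta ^ 5 * two_eq_zero
      · linear_combination Delta ^ 2 * two_eq_zero
    · simp [Fin.sum_univ_succ]; ring
    · simp [Fin.sum_univ_succ]; ring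

end HeckeModTwo

/-! ### Recursions for `T_3` and `T_5`, and a table for `T_5`. -/

namespace HeckeModTwo

open PowerSeries

instance : CharP (ZMod 2)⟦X⟧ 2 := CharTwo.of_one_ne_zero_of_two_eq_zero one_ne_zero two_eq_zero

theorem add_pow_two_pow (f g : (ZMod 2)⟦X⟧) (s : ℕ) :
    (f + g) ^ 2 ^ s = f ^ 2 ^ s + g ^ 2 ^ s :=
  add_pow_char_pow f g 2 s

/-- The 2^s-th power of x⁴ = xy + y⁴ has the same three terms, by additivity of Frobenius. -/
theorem heckeThree_add (s r : ℕ) :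
    heckeOp 3 (Delta ^ (4 * 2 ^ s + r)) = Delta ^ 2 ^ s * heckeOp 3 (Delta ^ (2 ^ s + r)) +
      Delta ^ (4 * 2 ^ s) * heckeOp 3 (Delta ^ r) := by
  have key (x y : (ZMod 2)⟦X⟧) (h : x ^ 4 = x * y + y ^ 4) :
      x ^ (4 * 2 ^ s) = x ^ 2 ^ s * y ^ 2 ^ s + y ^ (4 * 2 ^ s) := by
    rw [pow_mul, h, add_pow_two_pow, mul_pow, ← pow_mul]
  have h := modularEquation_three
  rw [heckeOp_delta_pow_add three_ne_zero ![2 ^ s, 0] ![2 ^ s, 4 * 2 ^ s]]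
  · simp [Fin.sum_univ_succ]
  · rw [key _ Delta (by linear_combination h - (expand 3 three_ne_zero Delta * Delta + Delta ^ 4) *
      two_eq_zero)]
    simp [Fin.sum_univ_succ]
  · rw [key _ (expand 3 three_ne_zero Delta) (by linear_combination h -
      (expand 3 three_ne_zero Delta * Delta + expand 3 three_ne_zero Delta ^ 4) * two_eq_zero)]
    simp [Fin.sum_univ_succ]

/-- The factor x² + y² collapses x⁶ + x⁴y² + x²y⁴ + y⁶ to x⁸ + y⁸. -/
theorem pow_eight_of_sextic {x y : (ZMod 2)⟦X⟧}
    (h : x ^ 6 + x ^ 4 * y ^ 2 + x ^ 2 * y ^ 4 + x * y + y ^ 6 = 0) :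
    x ^ 8 = x ^ 3 * y + x * y ^ 3 + y ^ 8 := by
  linear_combination (x ^ 2 + y ^ 2) * h - (x ^ 6 * y ^ 2 + x ^ 4 * y ^ 4 + x ^ 2 * y ^ 6 +
    x ^ 3 * y + x * y ^ 3 + y ^ 8) * two_eq_zero

/-- The square of the octic relation is reduced by y² times the sextic. The result contains x¹⁶ =
x⁴y⁴ + y¹⁶, of the same shape as the relation for p = 3; the other terms turn out to have lower
weight. -/
theorem pow_sixteen_of_sextic {x y : (ZMod 2)⟦X⟧}
    (h : x ^ 6 + x ^ 4 * y ^ 2 + x ^ 2 * y ^ 4 + x * y + y ^ 6 = 0) :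
    x ^ 16 = x ^ 4 * y ^ 4 + x * y ^ 3 + y ^ 8 + y ^ 16 := by
  have h8 := pow_eight_of_sextic h
  have : x ^ 16 = (x ^ 8) ^ 2 := by ring
  rw [this, h8]
  linear_combination y ^ 2 * h + (x ^ 3 * y ^ 9 + x * y ^ 11 - x * y ^ 3 - y ^ 8) * two_eq_zero

theorem heckeFive_add_eight (r : ℕ) :
    heckeOp 5 (Delta ^ (8 + r)) = Delta * heckeOp 5 (Delta ^ (3 + r)) +
      Delta ^ 3 * heckeOp 5 (Delta ^ (1 + r)) + Delta ^ 8 * heckeOp 5 (Delta ^ r) := by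
  have h := modularEquation_five
  rw [heckeOp_delta_pow_add (by norm_num) ![3, 1, 0] ![1, 3, 8]]
  · simp [Fin.sum_univ_succ, add_assoc]
  · rw [pow_eight_of_sextic h]
    simp [Fin.sum_univ_succ, add_assoc]
  · rw [pow_eight_of_sextic (x := Delta) (y := expand 5 (by norm_num) Delta)
      (by linear_combination h)]
    simp [Fin.sum_univ_succ, add_assoc]

theorem heckeFive_add (s r : ℕ) :
    heckeOp 5 (Delta ^ (16 * 2 ^ s + r)) =
      Delta ^ (4 * 2 ^ s) * heckeOp 5 (Delta ^ (4 * 2 ^ s + r)) +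
      Delta ^ (3 * 2 ^ s) * heckeOp 5 (Delta ^ (2 ^ s + r)) +
      Delta ^ (8 * 2 ^ s) * heckeOp 5 (Delta ^ r) +
      Delta ^ (16 * 2 ^ s) * heckeOp 5 (Delta ^ r) := by
  have key (x y : (ZMod 2)⟦X⟧) (h : x ^ 16 = x ^ 4 * y ^ 4 + x * y ^ 3 + y ^ 8 + y ^ 16) :
      x ^ (16 * 2 ^ s) = x ^ (4 * 2 ^ s) * y ^ (4 * 2 ^ s) + x ^ 2 ^ s * y ^ (3 * 2 ^ s) +
        y ^ (8 * 2 ^ s) + y ^ (16 * 2 ^ s) := by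
    rw [pow_mul, h, add_pow_two_pow, add_pow_two_pow, add_pow_two_pow, mul_pow, mul_pow]
    simp only [← pow_mul]
  have h := modularEquation_five
  rw [heckeOp_delta_pow_add (by norm_num) ![4 * 2 ^ s, 2 ^ s, 0, 0]
    ![4 * 2 ^ s, 3 * 2 ^ s, 8 * 2 ^ s, 16 * 2 ^ s]]
  · simp [Fin.sum_univ_succ, add_assoc]
  · rw [key _ _ (pow_sixteen_of_sextic h)]
    simp [Fin.sum_univ_succ, add_assoc]
  · rw [key Delta (expand 5 (by norm_num) Delta) (pow_sixteen_of_sextic (by linear_combination h))]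
    simp [Fin.sum_univ_succ, add_assoc]

theorem heckeOp_delta_even {p k : ℕ} (hp : Odd p) {f : (ZMod 2)⟦X⟧} (h : heckeOp p (Delta ^ k) =
    f) :
    heckeOp p (Delta ^ (2 * k)) = f ^ 2 := by
  rw [heckeOp_delta_pow_two_mul hp, h]

/-- Together with squaring for even exponents, this produces the odd values up to exponent 31 that
serve as base cases for `heckeFive_deltaOdd`. -/
theorem heckeFive_step {r : ℕ} {f g h : (ZMod 2)⟦X⟧} (hf : heckeOp 5 (Delta ^ (3 + r)) = f)
    (hg : heckeOp 5 (Delta ^ (1 + r)) = g) (hh : heckeOp 5 (Delta ^ r) = h) :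
    heckeOp 5 (Delta ^ (8 + r)) = Delta * f + Delta ^ 3 * g + Delta ^ 8 * h := by
  rw [heckeFive_add_eight, hf, hg, hh]

theorem heckeThree_seven : heckeOp 3 (Delta ^ 7) = Delta ^ 5 := by
  have h := heckeThree_add 0 3
  have h4 := heckeThree_four
  have h3 := heckeThree_three
  norm_num [h4, h3] at h
  rw [h]
  ring

theorem heckeFive_eleven : heckeOp 5 (Delta ^ 11) = 0 :=
  (heckeFive_step (r := 3) heckeFive_six heckeFive_four heckeFive_three).trans (by ring)

theorem heckeFive_twelve : heckeOp 5 (Delta ^ 12) = 0 :=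
  (heckeOp_delta_even (k := 6) (by decide) heckeFive_six).trans (by ring)

theorem heckeFive_thirteen : heckeOp 5 (Delta ^ 13) = Delta ^ 9 :=
  (heckeFive_step (r := 5) heckeFive_eight heckeFive_six heckeFive_five).trans (by ring)

theorem heckeFive_fourteen : heckeOp 5 (Delta ^ 14) = Delta ^ 6 :=
  (heckeOp_delta_even (k := 7) (by decide) heckeFive_seven).trans (by ring)

theorem heckeFive_fifteen : heckeOp 5 (Delta ^ 15) = Delta ^ 3 + Delta ^ 11 :=
  (heckeFive_step (r := 7) heckeFive_ten heckeFive_eight heckeFive_seven).trans (by ring)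

theorem heckeFive_sixteen : heckeOp 5 (Delta ^ 16) = 0 :=
  (heckeOp_delta_even (k := 8) (by decide) heckeFive_eight).trans (by ring)

theorem heckeFive_seventeen : heckeOp 5 (Delta ^ 17) = Delta ^ 5 :=
  (heckeFive_step (r := 9) heckeFive_twelve heckeFive_ten heckeFive_nine).trans (by ring)

theorem heckeFive_eighteen : heckeOp 5 (Delta ^ 18) = 0 :=
  (heckeOp_delta_even (k := 9) (by decide) heckeFive_nine).trans (by ring)

theorem heckeFive_nineteen : heckeOp 5 (Delta ^ 19) = Delta ^ 7 :=
  (heckeFive_step (r := 11) heckeFive_fourteen heckeFive_twelve heckeFive_eleven).trans (by ring)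

theorem heckeFive_twenty : heckeOp 5 (Delta ^ 20) = Delta ^ 4 :=
  (heckeOp_delta_even (k := 10) (by decide) heckeFive_ten).trans (by ring)

theorem heckeFive_twentyOne : heckeOp 5 (Delta ^ 21) = Delta ^ 9 + Delta ^ 17 :=
  (heckeFive_step (r := 13) heckeFive_sixteen heckeFive_fourteen heckeFive_thirteen).trans (by ring)

theorem heckeFive_twentyTwo : heckeOp 5 (Delta ^ 22) = 0 :=
  (heckeOp_delta_even (k := 11) (by decide) heckeFive_eleven).trans (by ring)

theorem heckeFive_twentyThree : heckeOp 5 (Delta ^ 23) = Delta ^ 11 + Delta ^ 19 :=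
  (heckeFive_step (r := 15) heckeFive_eighteen heckeFive_sixteen heckeFive_fifteen).trans (by ring)

theorem heckeFive_twentyFour : heckeOp 5 (Delta ^ 24) = 0 :=
  (heckeOp_delta_even (k := 12) (by decide) heckeFive_twelve).trans (by ring)

theorem heckeFive_twentyFive : heckeOp 5 (Delta ^ 25) = Delta ^ 5 + Delta ^ 13 :=
  (heckeFive_step (r := 17) heckeFive_twenty heckeFive_eighteen heckeFive_seventeen).trans (by ring)

theorem heckeFive_twentySix : heckeOp 5 (Delta ^ 26) = Delta ^ 18 :=
  (heckeOp_delta_even (k := 13) (by decide) heckeFive_thirteen).trans (by ring)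

theorem heckeFive_twentySeven : heckeOp 5 (Delta ^ 27) = Delta ^ 7 + Delta ^ 15 :=
  (heckeFive_step (r := 19) heckeFive_twentyTwo heckeFive_twenty heckeFive_nineteen).trans (by ring)

theorem heckeFive_twentyNine : heckeOp 5 (Delta ^ 29) = Delta ^ 17 + Delta ^ 25 :=
  (heckeFive_step (r := 21)
    heckeFive_twentyFour heckeFive_twentyTwo heckeFive_twentyOne).trans (by ring)

theorem heckeFive_thirtyOne : heckeOp 5 (Delta ^ 31) = Delta ^ 27 :=
  (heckeFive_step (r := 23)
    heckeFive_twentySix heckeFive_twentyFour heckeFive_twentyThree).trans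
      (by linear_combination Delta ^ 19 * two_eq_zero)

end HeckeModTwo

/-! ### Digit coordinates and the weight filtration. -/

namespace HeckeModTwo

open PowerSeries

/-- The number whose binary digits are those of `a`, moved to the even positions. -/
def spread (a : ℕ) : ℕ :=
  if a = 0 then 0 else 4 * spread (a / 2) + a % 2
termination_by a
decreasing_by omega

/-- The weight of an index: the binary digits at positions `2j` and `2j+1` count
`2 * 2^j` and `3 * 2^j`. -/
def weight (i : ℕ) : ℕ :=
  if i = 0 then 0 else 2 * weight (i / 4) + 2 * (i % 2) + 3 * (i / 2 % 2)
termination_by i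
decreasing_by omega

theorem spread_zero : spread 0 = 0 := by
  rw [spread, if_pos rfl]

theorem weight_zero : weight 0 = 0 := by
  rw [weight, if_pos rfl]

theorem spread_eq (a : ℕ) : spread a = 4 * spread (a / 2) + a % 2 := by
  rcases eq_or_ne a 0 with rfl | h
  · simp [spread_zero]
  · rw [spread, if_neg h]

theorem weight_eq (i : ℕ) : weight i = 2 * weight (i / 4) + 2 * (i % 2) + 3 * (i / 2 % 2) := by
  rcases eq_or_ne i 0 with rfl | h
  · simp [weight_zero]
  · rw [weight, if_neg h]

theorem weight_one : weight 1 = 2 := by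
  rw [weight_eq]; simp [weight_zero]

theorem weight_two : weight 2 = 3 := by
  rw [weight_eq]; simp [weight_zero]

theorem weight_four_mul (i : ℕ) : weight (4 * i) = 2 * weight i := by
  rw [weight_eq, show 4 * i / 4 = i by omega]
  omega

theorem weight_four_pow (j : ℕ) : weight (4 ^ j) = 2 * 2 ^ j := by
  induction j with
  | zero => exact weight_one
  | succ j ih => rw [pow_succ', weight_four_mul, ih, pow_succ']

theorem weight_two_mul_four_pow (j : ℕ) : weight (2 * 4 ^ j) = 3 * 2 ^ j := by
  induction j with
  | zero => exact weight_two
  | succ j ih => rw [pow_succ', mul_left_comm, weight_four_mul, ih, pow_succ']; ring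

/-- Carries never increase the weight: two digits at position 2j weigh 4·2^j against 3·2^j for the
digit at 2j+1, and two digits at 2j+1 weigh 6·2^j against 4·2^j for the digit at 2j+2. -/
theorem weight_add_le (i j : ℕ) : weight (i + j) ≤ weight i + weight j := by
  induction h : i + j using Nat.strong_induction_on generalizing i j with
  | _ n ih =>
    subst h
    rcases Nat.eq_zero_or_pos (i + j) with h0 | h0
    · have : i = 0 := by omega
      subst this
      have : j = 0 := by omega
      subst this
      simp
    rcases Nat.lt_or_ge (i % 4 + j % 4) 4 with hc | hc
    · have h1 := ih (i / 4 + j / 4) (by omega) _ _ rfl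
      have h2 : (i + j) / 4 = i / 4 + j / 4 := by omega
      rw [weight_eq (i + j), weight_eq i, weight_eq j, h2]
      have := Nat.mod_lt i (show 0 < 4 by norm_num)
      have := Nat.mod_lt j (show 0 < 4 by norm_num)
      omega
    · rcases Nat.lt_or_ge (i + j) 5 with h5 | h5
      · rw [weight_eq (i + j), weight_eq i, weight_eq j]
        have : i + j = 4 := by omega
        rw [this, show 4 / 4 = 1 from rfl, weight_one]
        omega
      have h1 := ih (i / 4 + j / 4) (by omega) _ _ rfl
      have h3 := ih (i / 4 + j / 4 + 1) (by omega) _ _ rfl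
      have h2 : (i + j) / 4 = i / 4 + j / 4 + 1 := by omega
      rw [weight_one] at h3
      rw [weight_eq (i + j), weight_eq i, weight_eq j, h2]
      have := Nat.mod_lt i (show 0 < 4 by norm_num)
      have := Nat.mod_lt j (show 0 < 4 by norm_num)
      omega

/-- The index with digits of `a` at even positions and digits of `b` at odd positions. -/
def index (a b : ℕ) : ℕ := spread a + 2 * spread b

theorem weight_index (a b : ℕ) : weight (index a b) = 2 * a + 3 * b := by
  induction h : a + b using Nat.strong_induction_on generalizing a b with
  | _ n ih =>
    subst h
    rcases Nat.eq_zero_or_pos (a + b) with h0 | h0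
    · have : a = 0 := by omega
      subst this
      have : b = 0 := by omega
      subst this
      simp [index, spread_zero, weight_zero]
    have h1 := ih (a / 2 + b / 2) (by omega) _ _ rfl
    have h2 := spread_eq a
    have h3 := spread_eq b
    rw [index] at h1 ⊢
    rw [weight_eq, show (spread a + 2 * spread b) / 4 = spread (a / 2) + 2 *
        spread (b / 2) by omega,
      h1]
    omega

theorem exists_index (i : ℕ) : ∃ a b, index a b = i := by
  induction i using Nat.strong_induction_on with
  | _ i ih =>
    rcases Nat.eq_zero_or_pos i with rfl | h0
    · exact ⟨0, 0, by simp [index, spread_zero]⟩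
    obtain ⟨a, b, h⟩ := ih (i / 4) (by omega)
    refine ⟨2 * a + i % 2, 2 * b + i / 2 % 2, ?_⟩
    have h2 := spread_eq (2 * a + i % 2)
    have h3 := spread_eq (2 * b + i / 2 % 2)
    rw [show (2 * a + i % 2) / 2 = a by omega] at h2
    rw [show (2 * b + i / 2 % 2) / 2 = b by omega] at h3
    rw [index] at h ⊢
    omega

theorem spread_add_two_pow {a j : ℕ} (h : a < 2 ^ j) : spread (a + 2 ^ j) = spread a + 4 ^ j := by
  induction j generalizing a with
  | zero =>
    have : a = 0 := by simpa using h
    subst this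
    rw [spread_eq]
    simp [spread_zero]
  | succ j ih =>
    rw [pow_succ'] at h
    have h1 := spread_eq (a + 2 ^ (j + 1))
    have h2 := spread_eq a
    have h3 := ih (a := a / 2) (by omega)
    rw [pow_succ', show (a + 2 * 2 ^ j) / 2 = a / 2 + 2 ^ j by omega, h3] at h1
    rw [pow_succ', h1, pow_succ']
    omega

theorem index_add_left {a b j : ℕ} (h : a < 2 ^ j) : index (a + 2 ^ j) b = index a b + 4 ^ j := by
  rw [index, index, spread_add_two_pow h]; ring

theorem index_add_right {a b j : ℕ} (h : b < 2 ^ j) :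
    index a (b + 2 ^ j) = index a b + 2 * 4 ^ j := by
  rw [index, index, spread_add_two_pow h]; ring

/-- The monomials `Δ^(2i+1)`. -/
noncomputable def deltaOdd (i : ℕ) : (ZMod 2)⟦X⟧ := Delta ^ (2 * i + 1)

theorem delta_pow_mul_deltaOdd (i j : ℕ) : Delta ^ (2 * j) * deltaOdd i = deltaOdd (i + j) := by
  rw [deltaOdd, deltaOdd, ← pow_add]
  ring_nf

/-- The span of the odd powers of `Δ` whose index has weight less than `c`. -/
noncomputable def weightLT (c : ℤ) : Submodule (ZMod 2) (ZMod 2)⟦X⟧ :=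
  Submodule.span (ZMod 2) {f | ∃ i : ℕ, (weight i : ℤ) < c ∧ f = deltaOdd i}

theorem deltaOdd_mem_weightLT {i : ℕ} {c : ℤ} (h : (weight i : ℤ) < c) : deltaOdd i ∈ weightLT c :=
  Submodule.subset_span ⟨i, h, rfl⟩

theorem weightLT_mono {c c' : ℤ} (h : c ≤ c') : weightLT c ≤ weightLT c' :=
  Submodule.span_mono fun _ ⟨i, hi, hf⟩ => ⟨i, hi.trans_le h, hf⟩

theorem delta_pow_mul_mem_weightLT {f : (ZMod 2)⟦X⟧} {c : ℤ} (hf : f ∈ weightLT c) (j : ℕ) :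
    Delta ^ (2 * j) * f ∈ weightLT (c + weight j) := by
  induction hf using Submodule.span_induction with
  | mem f hf =>
    obtain ⟨i, hi, rfl⟩ := hf
    rw [delta_pow_mul_deltaOdd]
    refine deltaOdd_mem_weightLT ?_
    have := weight_add_le i j
    zify at this
    linarith
  | zero => simp
  | add f g _ _ hf hg => rw [mul_add]; exact add_mem hf hg
  | smul a f _ hf => rw [mul_smul_comm]; exact Submodule.smul_mem _ _ hf

/-- The bound is an integer so that operators may lower it below zero, where an error term becomes
exactly zero. -/
theorem weightLT_eq_bot {c : ℤ} (h : c ≤ 0) : weightLT c = ⊥ := by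
  rw [weightLT, Submodule.span_eq_bot]
  rintro f ⟨i, hi, -⟩
  omega

end HeckeModTwo

/-! ### Leading terms of `T_3` and `T_5`. -/

namespace HeckeModTwo

open PowerSeries

/-- `heckeThree_add` in terms of indices; μ is the value 4^j or 2·4^j of one binary digit, and 4μ is
the next digit of the same coordinate. -/
theorem heckeThree_deltaOdd_add {μ s : ℕ} (h : 2 * μ = 2 ^ s) (i : ℕ) :
    heckeOp 3 (deltaOdd (i + 4 * μ)) = Delta ^ (2 * μ) * heckeOp 3 (deltaOdd (i + μ)) +
      Delta ^ (2 * (4 * μ)) * heckeOp 3 (deltaOdd i) := by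
  have := heckeThree_add s (2 * i + 1)
  rw [← h] at this
  rw [deltaOdd, deltaOdd, deltaOdd, show 2 * (i + 4 * μ) + 1 = 4 * (2 * μ) + (2 * i + 1) by ring,
      this]
  ring_nf

/-- With μ = 4ν the first two terms are those of the recursion for T_3; the bracket is an error
term, bounded in `heckeFive_extra_mem`. -/
theorem heckeFive_deltaOdd_add {ν s : ℕ} (h : 2 * ν = 2 ^ s) (i : ℕ) :
    heckeOp 5 (deltaOdd (i + 4 * (4 * ν))) =
      Delta ^ (2 * (4 * ν)) * heckeOp 5 (deltaOdd (i + 4 * ν)) +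
      Delta ^ (2 * (4 * (4 * ν))) * heckeOp 5 (deltaOdd i) +
      (Delta ^ (2 * (3 * ν)) * heckeOp 5 (deltaOdd (i + ν)) +
      Delta ^ (2 * (4 * (2 * ν))) * heckeOp 5 (deltaOdd i)) := by
  have := heckeFive_add s (2 * i + 1)
  rw [← h] at this
  rw [deltaOdd, deltaOdd, deltaOdd, deltaOdd,
    show 2 * (i + 4 * (4 * ν)) + 1 = 16 * (2 * ν) + (2 * i + 1) by ring, this]
  ring_nf

/-- The expected leading term of `T_3 Δ^(2i+1)` for `i = index a b`. -/
noncomputable def leadThree (a b : ℕ) : (ZMod 2)⟦X⟧ :=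
  if a = 0 then 0 else deltaOdd (index (a - 1) b)

/-- The expected leading term of `T_5 Δ^(2i+1)` for `i = index a b`. -/
noncomputable def leadFive (a b : ℕ) : (ZMod 2)⟦X⟧ :=
  if b = 0 then 0 else deltaOdd (index a (b - 1))

theorem leadThree_mem (a b : ℕ) : leadThree a b ∈ weightLT (2 * a + 3 * b - 2 + 1) := by
  rw [leadThree]
  split_ifs with h
  · exact zero_mem _
  · refine deltaOdd_mem_weightLT ?_
    rw [weight_index]
    omega

theorem leadFive_mem (a b : ℕ) : leadFive a b ∈ weightLT (2 * a + 3 * b - 3 + 1) := by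
  rw [leadFive]
  split_ifs with h
  · exact zero_mem _
  · refine deltaOdd_mem_weightLT ?_
    rw [weight_index]
    omega

/-- Errors in the two values of H are multiplied by Δ^(2μ) and Δ^(8μ), which raise the weight by at
most `weight μ` and `weight (4 * μ) = 2 * weight μ`. -/
theorem sub_mem_weightLT_of_recursion {H : (ZMod 2)⟦X⟧ →ₗ[ZMod 2] (ZMod 2)⟦X⟧} {i i₁ i₀ μ : ℕ}
    {E f f₀ f₁ : (ZMod 2)⟦X⟧} {c : ℤ}
    (hrec : H (deltaOdd i) = Delta ^ (2 * μ) * H (deltaOdd i₁) +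
      Delta ^ (2 * (4 * μ)) * H (deltaOdd i₀) + E) (hE : E ∈ weightLT c)
    (h₁ : H (deltaOdd i₁) - f₁ ∈ weightLT (c - weight μ))
    (h₀ : H (deltaOdd i₀) - f₀ ∈ weightLT (c - 2 * weight μ))
    (hf : Delta ^ (2 * μ) * f₁ + Delta ^ (2 * (4 * μ)) * f₀ - f ∈ weightLT c) :
    H (deltaOdd i) - f ∈ weightLT c := by
  have h2 := delta_pow_mul_mem_weightLT h₁ μ
  have h3 := delta_pow_mul_mem_weightLT h₀ (4 * μ)
  rw [weight_four_mul] at h3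
  push_cast at h3
  rw [sub_add_cancel] at h2 h3
  have := add_mem (add_mem (add_mem h2 h3) hf) hE
  convert this using 1
  rw [hrec]
  ring

/-- The induction step for the leading terms: the top digit of one of the two coordinates of the
index is removed. -/
theorem sub_mem_weightLT_step {H : (ZMod 2)⟦X⟧ →ₗ[ZMod 2] (ZMod 2)⟦X⟧} {g : ℕ → ℕ}
    {ℓ : ℕ → (ZMod 2)⟦X⟧} {ε m n : ℕ} {w : ℤ}
    (hg : ∀ {x j}, x < 2 ^ j → g (x + 2 ^ j) = g x + ε * 4 ^ j)
    (hwg : ∀ x, weight (g x) = m * x + n) (hw : ∀ j, weight (ε * 4 ^ j) = m * 2 ^ j)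
    (hw2 : ∀ j, weight (2 * (ε * 4 ^ j)) < 2 * (m * 2 ^ j))
    (hℓ : ∀ x : ℕ, ℓ x ∈ weightLT (m * x + n - w + 1))
    (hℓ1 : ∀ {x j}, x ≠ 0 → x < 2 ^ j → ℓ (x + 2 ^ j) = Delta ^ (2 * (ε * 4 ^ j)) * ℓ x)
    (hℓ0 : ∀ j, Delta ^ (2 * (ε * 4 ^ j)) * ℓ (2 ^ j) + Delta ^ (2 * (ε * 4 ^ (j + 1))) * ℓ 0 -
      ℓ (2 ^ (j + 1)) ∈ weightLT (m * 2 ^ (j + 1) + n - w))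
    {x j : ℕ} (hx : x < 2 ^ (j + 1)) {E : (ZMod 2)⟦X⟧}
    (hrec : H (deltaOdd (g x + 4 * (ε * 4 ^ j))) =
      Delta ^ (2 * (ε * 4 ^ j)) * H (deltaOdd (g x + ε * 4 ^ j)) +
      Delta ^ (2 * (4 * (ε * 4 ^ j))) * H (deltaOdd (g x)) + E)
    (hE : E ∈ weightLT (weight (g x) + 2 * weight (ε * 4 ^ j) - w))
    (h0 : H (deltaOdd (g x)) - ℓ x ∈ weightLT (m * x + n - w))
    (h1 : x < 2 ^ j → H (deltaOdd (g (x + 2 ^ j))) - ℓ (x + 2 ^ j) ∈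
      weightLT (m * (x + 2 ^ j : ℕ) + n - w))
    (hb : H (deltaOdd (g x + ε * 4 ^ j)) ∈ weightLT (weight (g x + ε * 4 ^ j) - w + 1)) :
    H (deltaOdd (g (x + 2 ^ (j + 1)))) - ℓ (x + 2 ^ (j + 1)) ∈
      weightLT (m * (x + 2 ^ (j + 1) : ℕ) + n - w) := by
  have hwj := hw j
  have hwj2 := hw2 j
  have hp : (2 : ℕ) ^ (j + 1) = 2 * 2 ^ j := pow_succ' ..
  have hq : ε * 4 ^ (j + 1) = 4 * (ε * 4 ^ j) := by ring
  have hc : (m * (x + 2 ^ (j + 1) : ℕ) + n - w : ℤ) = weight (g x) + 2 * weight (ε * 4 ^ j) - w :=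
      by
    rw [hwg, hwj]; push_cast; ring
  have hl {x : ℕ} (hx0 : x ≠ 0) (hx : x < 2 ^ (j + 1)) :
      Delta ^ (2 * (4 * (ε * 4 ^ j))) * ℓ x - ℓ (x + 2 ^ (j + 1)) = 0 := by
    rw [hℓ1 hx0 hx, hq, sub_self]
  rw [hg hx, hq]
  have h0' := weightLT_mono (c' := m * (x + 2 ^ (j + 1) : ℕ) + n - w - 2 * weight (ε * 4 ^ j))
    (by rw [hc, hwg]; push_cast; linarith) h0
  rw [← hc] at hE
  -- If the digit 2^j of x is 0, no carry occurs. For x ≠ 0 the summand with Δ^(8μ) gives the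
  -- leading term, and the other one gives Δ^(4μ) `ℓ x`, of lower weight as the digit 2μ weighs less
  -- than two digits μ. At x = 0 the leading term may come from the first summand instead, whence
  -- `hℓ0`.
  rcases Nat.lt_or_ge x (2 ^ j) with hlt | hge
  · refine sub_mem_weightLT_of_recursion (f₁ := ℓ (x + 2 ^ j)) hrec hE ?_ h0' ?_
    · rw [← hg hlt]
      refine weightLT_mono ?_ (h1 hlt)
      rw [hwj]; push_cast; rw [pow_succ]; linarith
    · rcases eq_or_ne x 0 with rfl | hx0
      · rw [zero_add, zero_add, ← hq]
        exact_mod_cast hℓ0 j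
      · rw [add_sub_assoc (Delta ^ (2 * (ε * 4 ^ j)) * _), hl hx0 hx, add_zero, hℓ1 hx0 hlt,
          ← mul_assoc, ← pow_add, ← mul_add,
          ← two_mul]
        refine weightLT_mono ?_ (delta_pow_mul_mem_weightLT (hℓ x) _)
        rw [hc, hwg, hwj]
        push_cast
        zify at hwj2
        linarith
  -- If the digit 2^j of x is 1, adding μ causes a carry; the weight lost makes the first summand
  -- negligible.
  · refine sub_mem_weightLT_of_recursion (f₁ := 0) hrec hE ?_ h0' ?_
    · rw [sub_zero]
      refine weightLT_mono ?_ hb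
      obtain ⟨y, rfl⟩ := Nat.exists_eq_add_of_le' hge
      have e := weight_add_le (g y) (2 * (ε * 4 ^ j))
      rw [hc, hg (x := y) (by omega)]
      rw [two_mul, ← add_assoc] at e
      have e2 := hwg (y + 2 ^ j)
      rw [hg (x := y) (by omega)] at e2
      rw [e2]
      rw [hwg, ← two_mul] at e
      zify at e hwj2 hwj
      push_cast
      linarith
    · rw [mul_zero, zero_add, hl (by have := Nat.one_le_two_pow (n := j); omega) hx]
      exact zero_mem _

/-- The case x = 0 for the coordinate that the operator does not lower: there `ℓ 0` itself
propagates and the first summand has lower weight. -/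
theorem lead_zero_mem {ℓ : ℕ → (ZMod 2)⟦X⟧} {ε m n : ℕ} {w : ℤ}
    (hw2 : ∀ j, weight (2 * (ε * 4 ^ j)) < 2 * (m * 2 ^ j))
    (hℓ : ∀ x : ℕ, ℓ x ∈ weightLT (m * x + n - w + 1))
    (hℓ1 : ∀ {x j}, x < 2 ^ j → ℓ (x + 2 ^ j) = Delta ^ (2 * (ε * 4 ^ j)) * ℓ x) (j : ℕ) :
    Delta ^ (2 * (ε * 4 ^ j)) * ℓ (2 ^ j) + Delta ^ (2 * (ε * 4 ^ (j + 1))) * ℓ 0 -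
      ℓ (2 ^ (j + 1)) ∈ weightLT (m * 2 ^ (j + 1) + n - w) := by
  have h1 := hℓ1 (x := 0) (j := j) (by positivity)
  have h2 := hℓ1 (x := 0) (j := j + 1) (by positivity)
  rw [zero_add] at h1 h2
  rw [h1, h2, add_sub_cancel_right, ← mul_assoc, ← pow_add, ← mul_add, ← two_mul]
  refine weightLT_mono ?_ (delta_pow_mul_mem_weightLT (hℓ 0) _)
  have := hw2 j
  zify at this
  rw [pow_succ]
  push_cast
  linarith

theorem weight_index_cast (a b : ℕ) : (weight (index a b) : ℤ) = 2 * a + 3 * b := by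
  rw [weight_index]; push_cast; rfl

theorem exists_eq_add_two_pow {a n : ℕ} (ha : 2 ^ n ≤ a) :
    ∃ j a', a' < 2 ^ (j + n) ∧ a = a' + 2 ^ (j + n) := by
  have ha0 : a ≠ 0 := (lt_of_lt_of_le (by positivity) ha).ne'
  have h1 : n ≤ Nat.log 2 a := (Nat.le_log_iff_pow_le one_lt_two ha0).2 ha
  have h2 := Nat.pow_log_le_self 2 ha0
  have h3 := Nat.lt_pow_succ_log_self one_lt_two a
  refine ⟨Nat.log 2 a - n, a - 2 ^ Nat.log 2 a, ?_, ?_⟩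
  · rw [Nat.sub_add_cancel h1]
    rw [pow_succ] at h3
    omega
  · rw [Nat.sub_add_cancel h1]
    omega

theorem weight_two_mul_lt_left (j : ℕ) : weight (2 * (1 * 4 ^ j)) < 2 * (2 * 2 ^ j) := by
  have := Nat.one_le_two_pow (n := j)
  rw [one_mul, weight_two_mul_four_pow]
  omega

theorem weight_two_mul_lt_right (j : ℕ) : weight (2 * (2 * 4 ^ j)) < 2 * (3 * 2 ^ j) := by
  have := Nat.one_le_two_pow (n := j)
  rw [← mul_assoc, show 2 * 2 * 4 ^ j = 4 ^ (j + 1) by ring, weight_four_pow, pow_succ]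
  omega

theorem leadThree_add_left {a b j : ℕ} (ha : a ≠ 0) (h : a < 2 ^ j) :
    leadThree (a + 2 ^ j) b = Delta ^ (2 * (1 * 4 ^ j)) * leadThree a b := by
  rw [leadThree, leadThree, if_neg ha, if_neg (by omega), delta_pow_mul_deltaOdd,
    Nat.sub_add_comm (by omega), index_add_left (by omega), one_mul]

theorem leadFive_add_right {a b j : ℕ} (hb : b ≠ 0) (h : b < 2 ^ j) :
    leadFive a (b + 2 ^ j) = Delta ^ (2 * (2 * 4 ^ j)) * leadFive a b := by
  rw [leadFive, leadFive, if_neg hb, if_neg (by omega), delta_pow_mul_deltaOdd,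
    Nat.sub_add_comm (by omega), index_add_right (by omega)]

theorem leadThree_add_right {a b j : ℕ} (h : b < 2 ^ j) :
    leadThree a (b + 2 ^ j) = Delta ^ (2 * (2 * 4 ^ j)) * leadThree a b := by
  rw [leadThree, leadThree]
  split_ifs
  · rw [mul_zero]
  · rw [delta_pow_mul_deltaOdd, index_add_right h]

theorem leadFive_add_left {a b j : ℕ} (h : a < 2 ^ j) :
    leadFive (a + 2 ^ j) b = Delta ^ (2 * (1 * 4 ^ j)) * leadFive a b := by
  rw [leadFive, leadFive]
  split_ifs
  · rw [mul_zero]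
  · rw [delta_pow_mul_deltaOdd, index_add_left h, one_mul]

/-- In the coordinate that is lowered, 2^(j+1) - 1 = (2^j - 1) + 2^j, so the leading term comes from
the first summand. -/
theorem leadThree_two_pow (b j : ℕ) :
    Delta ^ (2 * (1 * 4 ^ j)) * leadThree (2 ^ j) b +
      Delta ^ (2 * (1 * 4 ^ (j + 1))) * leadThree 0 b - leadThree (2 ^ (j + 1)) b = 0 := by
  have h1 : 1 ≤ 2 ^ j := Nat.one_le_two_pow
  have e1 := index_add_left (b := b) (a := 2 ^ j - 1) (j := j) (by omega)
  have e2 : 2 ^ j - 1 + 2 ^ j = 2 ^ (j + 1) - 1 := by rw [pow_succ]; omega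
  rw [leadThree, leadThree, leadThree, if_pos rfl, if_neg (by omega), if_neg (by positivity),
    delta_pow_mul_deltaOdd, one_mul, ← e1, e2, mul_zero, add_zero, sub_self]

theorem leadFive_two_pow (a j : ℕ) :
    Delta ^ (2 * (2 * 4 ^ j)) * leadFive a (2 ^ j) +
      Delta ^ (2 * (2 * 4 ^ (j + 1))) * leadFive a 0 - leadFive a (2 ^ (j + 1)) = 0 := by
  have h1 : 1 ≤ 2 ^ j := Nat.one_le_two_pow
  have e1 := index_add_right (a := a) (b := 2 ^ j - 1) (j := j) (by omega)
  have e2 : 2 ^ j - 1 + 2 ^ j = 2 ^ (j + 1) - 1 := by rw [pow_succ]; omega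
  rw [leadFive, leadFive, leadFive, if_pos rfl, if_neg (by omega), if_neg (by positivity),
    delta_pow_mul_deltaOdd, ← e1, e2, mul_zero, add_zero, sub_self]

/-- Strong induction on the index, removing the top digit of a or of b. What remains is a, b < 2,
that is, the exponents 1, 3, 5, 7. -/
theorem heckeThree_deltaOdd (a b : ℕ) :
    heckeOp 3 (deltaOdd (index a b)) - leadThree a b ∈ weightLT (2 * a + 3 * b - 2) := by
  induction h : index a b using Nat.strong_induction_on generalizing a b with
  | _ i ih =>
    have hb (i') (hi' : i' < i) : heckeOp 3 (deltaOdd i') ∈ weightLT (weight i' - 2 + 1) := by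
      obtain ⟨a', b', rfl⟩ := exists_index i'
      have := add_mem (weightLT_mono (by omega) (ih _ hi' a' b' rfl)) (leadThree_mem a' b')
      rw [sub_add_cancel] at this
      rwa [weight_index_cast]
    subst h
    by_cases ha : 2 ^ 1 ≤ a
    · obtain ⟨j, a, haj, rfl⟩ := exists_eq_add_two_pow ha
      have hpos : 1 ≤ 4 ^ j := Nat.one_le_pow _ _ (by norm_num)
      have hi := index_add_left (b := b) haj
      rw [pow_succ' 4] at hi
      rw [hi] at ih hb
      have := sub_mem_weightLT_step (H := heckeOp 3) (g := fun x => index x b)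
        (ℓ := fun x => leadThree x b) (ε := 1) (m := 2) (n := 3 * b) (w := 2) (E := 0)
        (fun h => by rw [one_mul, index_add_left h]) (fun x => weight_index x b)
        (fun j => by rw [one_mul, weight_four_pow]) weight_two_mul_lt_left
        (fun x => by exact_mod_cast leadThree_mem x b) leadThree_add_left
        (fun j => by rw [leadThree_two_pow]; exact zero_mem _)
        haj (by
          rw [one_mul, add_zero]
          exact heckeThree_deltaOdd_add (s := 2 * j + 1) (by rw [pow_succ, pow_mul]; ring) _)
        (zero_mem _) (by exact_mod_cast ih (index a b) (by omega) a b rfl)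
        (fun hlt => by
          exact_mod_cast ih (index (a + 2 ^ j) b) (by rw [index_add_left hlt]; omega) _ b rfl)
        (hb _ (by omega))
      exact_mod_cast this
    by_cases hb2 : 2 ^ 1 ≤ b
    · obtain ⟨j, b, hbj, rfl⟩ := exists_eq_add_two_pow hb2
      have hpos : 1 ≤ 4 ^ j := Nat.one_le_pow _ _ (by norm_num)
      have hi := index_add_right (a := a) hbj
      rw [pow_succ' 4] at hi
      rw [hi] at ih hb
      have hm (x : ℕ) : leadThree a x ∈ weightLT ((3 : ℕ) * x + (2 * a : ℕ) - 2 + 1) := by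
        have := leadThree_mem a x
        rw [add_comm (2 * (a : ℤ))] at this
        exact_mod_cast this
      have := sub_mem_weightLT_step (H := heckeOp 3) (g := fun x => index a x)
        (ℓ := fun x => leadThree a x) (ε := 2) (m := 3) (n := 2 * a) (w := 2) (E := 0)
        index_add_right (fun x => by rw [weight_index, add_comm])
        weight_two_mul_four_pow weight_two_mul_lt_right hm
        (fun _ h => leadThree_add_right h)
        (lead_zero_mem weight_two_mul_lt_right hm leadThree_add_right)
        hbj (by
          rw [add_zero]
          exact heckeThree_deltaOdd_add (s := 2 * j + 2) (by rw [pow_add, pow_mul]; ring) _)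
        (zero_mem _) (by
          have := ih (index a b) (by omega) a b rfl
          rw [add_comm (2 * (a : ℤ))] at this
          exact_mod_cast this)
        (fun hlt => by
          have := ih (index a (b + 2 ^ j)) (by rw [index_add_right hlt]; omega) a _ rfl
          rw [add_comm (2 * (a : ℤ))] at this
          exact_mod_cast this)
        (hb _ (by omega))
      rw [add_comm (2 * (a : ℤ))]
      exact_mod_cast this
    have hs0 := spread_zero
    have hs1 : spread 1 = 1 := by rw [spread_eq]; simp [hs0]
    have h1 : a < 2 := by omega
    have h2 : b < 2 := by omega
    interval_cases a <;> interval_cases b <;>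
      simp [index, leadThree, deltaOdd, hs0, hs1, heckeThree_one, heckeThree_three,
        heckeThree_five, heckeThree_seven]

/-- By subadditivity 3ν weighs at most ν plus 2ν, and 2ν weighs less than two copies of ν, so both
terms fall strictly below the main weight. -/
theorem heckeFive_extra_mem {i ν : ℕ}
    (hν : weight (2 * ν) < 2 * weight ν)
    (h1 : heckeOp 5 (deltaOdd (i + ν)) ∈ weightLT (weight (i + ν) - 3 + 1))
    (h0 : heckeOp 5 (deltaOdd i) ∈ weightLT (weight i - 3 + 1)) :
    Delta ^ (2 * (3 * ν)) * heckeOp 5 (deltaOdd (i + ν)) +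
      Delta ^ (2 * (4 * (2 * ν))) * heckeOp 5 (deltaOdd i) ∈
      weightLT (weight i + 2 * weight (4 * ν) - 3) := by
  have e1 := weight_add_le i ν
  have e2 := weight_add_le ν (2 * ν)
  rw [show ν + 2 * ν = 3 * ν by ring] at e2
  refine add_mem (weightLT_mono ?_ (delta_pow_mul_mem_weightLT h1 _))
    (weightLT_mono ?_ (delta_pow_mul_mem_weightLT h0 _))
  · rw [weight_four_mul]; omega
  · rw [weight_four_mul, weight_four_mul]; omega

/-- The recursion for T_5 involves the digit two places below the one removed, so coordinates below
4 must be checked directly: the odd exponents up to 31. -/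
theorem heckeFive_deltaOdd_of_lt {a b : ℕ} (ha : a < 4) (hb : b < 4) :
    heckeOp 5 (deltaOdd (index a b)) - leadFive a b ∈ weightLT (2 * a + 3 * b - 3) := by
  have hs0 := spread_zero
  have hs1 : spread 1 = 1 := by rw [spread_eq]; simp [hs0]
  have hs2 : spread 2 = 4 := by rw [spread_eq]; simp [hs1]
  have hs3 : spread 3 = 5 := by rw [spread_eq]; simp [hs1]
  have h (i : ℕ) (c : ℤ) (hc : (weight i : ℤ) < c) : Delta ^ (2 * i + 1) ∈ weightLT c :=
    deltaOdd_mem_weightLT hc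
  interval_cases a <;> interval_cases b <;>
    simp [index, leadFive, deltaOdd, hs0, hs1, hs2, hs3, heckeFive_one, heckeFive_three,
      heckeFive_five, heckeFive_seven, heckeFive_nine, heckeFive_eleven, heckeFive_thirteen,
      heckeFive_fifteen, heckeFive_seventeen, heckeFive_nineteen, heckeFive_twentyOne,
      heckeFive_twentyThree, heckeFive_twentyFive, heckeFive_twentySeven, heckeFive_twentyNine,
      heckeFive_thirtyOne]
  · exact h 4 _ (by rw [weight_eq]; simp [weight_one])
  · exact h 5 _ (by rw [weight_eq]; simp [weight_one])
  · exact h 2 _ (by rw [weight_two]; simp)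
  · exact h 8 _ (by rw [weight_eq]; simp [weight_two])
  · exact h 1 _ (by rw [weight_one]; simp)
  · exact h 3 _ (by rw [weight_eq]; simp [weight_zero])

theorem heckeFive_deltaOdd (a b : ℕ) :
    heckeOp 5 (deltaOdd (index a b)) - leadFive a b ∈ weightLT (2 * a + 3 * b - 3) := by
  induction h : index a b using Nat.strong_induction_on generalizing a b with
  | _ i ih =>
    have hb (i') (hi' : i' < i) : heckeOp 5 (deltaOdd i') ∈ weightLT (weight i' - 3 + 1) := by
      obtain ⟨a', b', rfl⟩ := exists_index i'
      have := add_mem (weightLT_mono (by omega) (ih _ hi' a' b' rfl)) (leadFive_mem a' b')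
      rw [sub_add_cancel] at this
      rwa [weight_index_cast]
    subst h
    by_cases ha : 2 ^ 2 ≤ a
    · obtain ⟨t, a, haj, rfl⟩ := exists_eq_add_two_pow ha
      have hpos : 1 ≤ 4 ^ t := Nat.one_le_pow _ _ (by norm_num)
      have hi := index_add_left (b := b) haj
      have hq : 4 ^ (t + 1) = 4 * 4 ^ t := pow_succ' ..
      rw [pow_succ' 4, hq] at hi
      rw [hi] at ih hb
      have hm (x : ℕ) : leadFive x b ∈ weightLT ((2 : ℕ) * x + (3 * b : ℕ) - 3 + 1) := by
        exact_mod_cast leadFive_mem x b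
      have hl0 := lead_zero_mem (ℓ := fun x => leadFive x b) (ε := 1) weight_two_mul_lt_left hm
        leadFive_add_left
      have := sub_mem_weightLT_step (H := heckeOp 5) (g := fun x => index x b)
        (ℓ := fun x => leadFive x b) (ε := 1) (m := 2) (n := 3 * b) (w := 3) (j := t + 1)
        (fun h => by rw [one_mul, index_add_left h]) (fun x => weight_index x b)
        (fun j => by rw [one_mul, weight_four_pow]) weight_two_mul_lt_left
        hm (fun _ h => leadFive_add_left h) hl0
        haj (by
          rw [one_mul, hq]
          exact heckeFive_deltaOdd_add (s := 2 * t + 1) (by rw [pow_succ, pow_mul]; ring) _)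
        (by
          rw [one_mul, hq]
          refine heckeFive_extra_mem ?_ (hb _ (by omega)) (hb _ (by omega))
          have := weight_two_mul_lt_left t
          rwa [one_mul, ← weight_four_pow] at this)
        (by exact_mod_cast ih (index a b) (by omega) a b rfl)
        (fun hlt => by
          exact_mod_cast ih (index (a + 2 ^ (t + 1)) b) (by rw [index_add_left hlt]; omega) _ b rfl)
        (hb _ (by omega))
      exact_mod_cast this
    by_cases hb2 : 2 ^ 2 ≤ b
    · obtain ⟨t, b, hbj, rfl⟩ := exists_eq_add_two_pow hb2
      have hpos : 1 ≤ 4 ^ t := Nat.one_le_pow _ _ (by norm_num)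
      have hi := index_add_right (a := a) hbj
      have hq : 4 ^ (t + 1) = 4 * 4 ^ t := pow_succ' ..
      rw [pow_succ' 4, hq] at hi
      rw [hi] at ih hb
      have hm (x : ℕ) : leadFive a x ∈ weightLT ((3 : ℕ) * x + (2 * a : ℕ) - 3 + 1) := by
        have := leadFive_mem a x
        rw [add_comm (2 * (a : ℤ))] at this
        exact_mod_cast this
      have := sub_mem_weightLT_step (H := heckeOp 5) (g := fun x => index a x)
        (ℓ := fun x => leadFive a x) (ε := 2) (m := 3) (n := 2 * a) (w := 3) (j := t + 1)
        index_add_right (fun x => by rw [weight_index, add_comm])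
        weight_two_mul_four_pow weight_two_mul_lt_right hm leadFive_add_right
        (fun j => by rw [leadFive_two_pow]; exact zero_mem _)
        hbj (by
          rw [hq, mul_left_comm 2 4]
          exact heckeFive_deltaOdd_add (s := 2 * t + 2) (by rw [pow_add, pow_mul]; ring) _)
        (by
          rw [hq, mul_left_comm 2 4]
          refine heckeFive_extra_mem ?_ (hb _ (by omega)) (hb _ (by omega))
          have := weight_two_mul_lt_right t
          rwa [← weight_two_mul_four_pow] at this)
        (by
          have := ih (index a b) (by omega) a b rfl
          rw [add_comm (2 * (a : ℤ))] at this
          exact_mod_cast this)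
        (fun hlt => by
          have := ih (index a (b + 2 ^ (t + 1))) (by rw [index_add_right hlt]; omega) a _ rfl
          rw [add_comm (2 * (a : ℤ))] at this
          exact_mod_cast this)
        (hb _ (by omega))
      rw [add_comm (2 * (a : ℤ))]
      exact_mod_cast this
    exact heckeFive_deltaOdd_of_lt (by omega) (by omega)

end HeckeModTwo

/-! ### The monomials `T_3^a T_5^b` and the coefficient of q. -/

namespace HeckeModTwo

open PowerSeries

theorem heckeThree_mem_weightLT {f : (ZMod 2)⟦X⟧} {c : ℤ} (hf : f ∈ weightLT c) :
    heckeOp 3 f ∈ weightLT (c - 2) := by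
  induction hf using Submodule.span_induction with
  | mem f hf =>
    obtain ⟨i, hi, rfl⟩ := hf
    obtain ⟨a, b, rfl⟩ := exists_index i
    rw [weight_index_cast] at hi
    have := add_mem (weightLT_mono (by omega) (heckeThree_deltaOdd a b)) (leadThree_mem a b)
    rw [sub_add_cancel] at this
    exact weightLT_mono (by omega) this
  | zero => simp
  | add f g _ _ hf hg => rw [map_add]; exact add_mem hf hg
  | smul a f _ hf => rw [map_smul]; exact Submodule.smul_mem _ _ hf

theorem heckeFive_mem_weightLT {f : (ZMod 2)⟦X⟧} {c : ℤ} (hf : f ∈ weightLT c) :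
    heckeOp 5 f ∈ weightLT (c - 3) := by
  induction hf using Submodule.span_induction with
  | mem f hf =>
    obtain ⟨i, hi, rfl⟩ := hf
    obtain ⟨a, b, rfl⟩ := exists_index i
    rw [weight_index_cast] at hi
    have := add_mem (weightLT_mono (by omega) (heckeFive_deltaOdd a b)) (leadFive_mem a b)
    rw [sub_add_cancel] at this
    exact weightLT_mono (by omega) this
  | zero => simp
  | add f g _ _ hf hg => rw [map_add]; exact add_mem hf hg
  | smul a f _ hf => rw [map_smul]; exact Submodule.smul_mem _ _ hf

theorem heckeThree_pow_mem_weightLT {f : (ZMod 2)⟦X⟧} {c : ℤ} (hf : f ∈ weightLT c) (k : ℕ) :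
    (heckeOp 3 ^ k) f ∈ weightLT (c - 2 * k) := by
  induction k with
  | zero => simpa using hf
  | succ k ih =>
    rw [pow_succ', Module.End.mul_apply]
    exact weightLT_mono (by push_cast; linarith) (heckeThree_mem_weightLT ih)

theorem heckeFive_pow_mem_weightLT {f : (ZMod 2)⟦X⟧} {c : ℤ} (hf : f ∈ weightLT c) (k : ℕ) :
    (heckeOp 5 ^ k) f ∈ weightLT (c - 3 * k) := by
  induction k with
  | zero => simpa using hf
  | succ k ih =>
    rw [pow_succ', Module.End.mul_apply]
    exact weightLT_mono (by push_cast; linarith) (heckeFive_mem_weightLT ih)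

/-- The operator `T_3^a T_5^b`, for `d = (a, b)`. -/
noncomputable def heckeMonomial (d : Fin 2 →₀ ℕ) : Module.End (ZMod 2) (ZMod 2)⟦X⟧ :=
  heckeOp 3 ^ d 0 * heckeOp 5 ^ d 1

theorem heckeMonomial_mem_weightLT {f : (ZMod 2)⟦X⟧} {c : ℤ} (hf : f ∈ weightLT c)
    (d : Fin 2 →₀ ℕ) : heckeMonomial d f ∈ weightLT (c - 2 * d 0 - 3 * d 1) := by
  rw [heckeMonomial, Module.End.mul_apply]
  exact weightLT_mono (by linarith)
    (heckeThree_pow_mem_weightLT (heckeFive_pow_mem_weightLT hf (d 1)) (d 0))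

theorem heckeThree_pow_deltaOdd (k a b : ℕ) :
    (heckeOp 3 ^ k) (deltaOdd (index (a + k) b)) - deltaOdd (index a b) ∈
      weightLT (2 * a + 3 * b) := by
  induction k with
  | zero => simp
  | succ k ih =>
    have h := heckeThree_pow_mem_weightLT (heckeThree_deltaOdd (a + (k + 1)) b) k
    rw [leadThree, if_neg (by omega), map_sub, ← Module.End.mul_apply, ← pow_succ,
      show a + (k + 1) - 1 = a + k by omega] at h
    have := add_mem (weightLT_mono (c' := 2 * a + 3 * b) (by push_cast; linarith) h) ih
    rwa [sub_add_sub_cancel] at this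

theorem heckeFive_pow_deltaOdd (k a b : ℕ) :
    (heckeOp 5 ^ k) (deltaOdd (index a (b + k))) - deltaOdd (index a b) ∈
      weightLT (2 * a + 3 * b) := by
  induction k with
  | zero => simp
  | succ k ih =>
    have h := heckeFive_pow_mem_weightLT (heckeFive_deltaOdd a (b + (k + 1))) k
    rw [leadFive, if_neg (by omega), map_sub, ← Module.End.mul_apply, ← pow_succ,
      show b + (k + 1) - 1 = b + k by omega] at h
    have := add_mem (weightLT_mono (c' := 2 * a + 3 * b) (by push_cast; linarith) h) ih
    rwa [sub_add_sub_cancel] at this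

/-- The index attached to a pair of exponents. -/
def indexOf (d : Fin 2 →₀ ℕ) : ℕ := index (d 0) (d 1)

/-- The weight of a pair of exponents. -/
def degWeight (d : Fin 2 →₀ ℕ) : ℕ := 2 * d 0 + 3 * d 1

theorem weight_indexOf (d : Fin 2 →₀ ℕ) : weight (indexOf d) = degWeight d :=
  weight_index _ _

theorem exists_indexOf (i : ℕ) : ∃ d, indexOf d = i := by
  obtain ⟨a, b, h⟩ := exists_index i
  exact ⟨Finsupp.single 0 a + Finsupp.single 1 b, by simpa [indexOf] using h⟩

/-- The leading term reaches index 0, and the error lies in `weightLT 0`, which is zero. -/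
theorem heckeMonomial_deltaOdd_self (d : Fin 2 →₀ ℕ) :
    heckeMonomial d (deltaOdd (indexOf d)) = Delta := by
  have h5 := heckeThree_pow_mem_weightLT (heckeFive_pow_deltaOdd (d 1) (d 0) 0) (d 0)
  have h3 := heckeThree_pow_deltaOdd (d 0) 0 0
  rw [zero_add] at h3 h5
  have := add_mem (weightLT_mono (c' := 0) (by simp) h5) (weightLT_mono (c' := 0) (by simp) h3)
  rw [weightLT_eq_bot le_rfl, Submodule.mem_bot, map_sub, ← Module.End.mul_apply,
    sub_add_sub_cancel, sub_eq_zero] at this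
  rw [heckeMonomial, indexOf, this]
  simp [deltaOdd, index, spread_zero]

theorem heckeMonomial_deltaOdd_of_lt {d : Fin 2 →₀ ℕ} {i : ℕ} (h : weight i < degWeight d) :
    heckeMonomial d (deltaOdd i) = 0 := by
  have := heckeMonomial_mem_weightLT (deltaOdd_mem_weightLT (i := i) (lt_add_one _)) d
  rw [degWeight] at h
  rwa [weightLT_eq_bot (by omega), Submodule.mem_bot] at this

/-- After a steps the coordinate is 0, where T_3 has no leading term; the next step loses at least
one more unit of weight than usual. -/
theorem heckeThree_pow_deltaOdd_of_lt {k a : ℕ} (h : a < k) (b : ℕ) :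
    (heckeOp 3 ^ k) (deltaOdd (index a b)) ∈ weightLT (2 * a + 3 * b - 2 * k) := by
  obtain ⟨m, rfl⟩ := Nat.exists_eq_add_of_lt h
  have h1 := heckeThree_mem_weightLT (heckeThree_pow_deltaOdd a 0 b)
  have h2 := heckeThree_deltaOdd 0 b
  rw [leadThree, if_pos rfl, sub_zero] at h2
  rw [zero_add, map_sub] at h1
  have h3 := add_mem h1 h2
  rw [sub_add_cancel, ← Module.End.mul_apply, ← pow_succ'] at h3
  have h4 := heckeThree_pow_mem_weightLT h3 m
  rw [← Module.End.mul_apply, ← pow_add] at h4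
  rw [show a + m + 1 = m + (a + 1) by ring]
  exact weightLT_mono (by push_cast; linarith) h4

theorem heckeFive_pow_deltaOdd_of_lt {k b : ℕ} (h : b < k) (a : ℕ) :
    (heckeOp 5 ^ k) (deltaOdd (index a b)) ∈ weightLT (2 * a + 3 * b - 3 * k) := by
  obtain ⟨m, rfl⟩ := Nat.exists_eq_add_of_lt h
  have h1 := heckeFive_mem_weightLT (heckeFive_pow_deltaOdd b a 0)
  have h2 := heckeFive_deltaOdd a 0
  rw [leadFive, if_pos rfl, sub_zero] at h2
  rw [zero_add, map_sub] at h1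
  have h3 := add_mem h1 h2
  rw [sub_add_cancel, ← Module.End.mul_apply, ← pow_succ'] at h3
  have h4 := heckeFive_pow_mem_weightLT h3 m
  rw [← Module.End.mul_apply, ← pow_add] at h4
  rw [show b + m + 1 = m + (b + 1) by ring]
  exact weightLT_mono (by push_cast; linarith) h4

/-- Distinct pairs of equal weight have some coordinate of e smaller than that of d, and exhausting
this coordinate costs the extra unit that leaves nothing. -/
theorem heckeMonomial_deltaOdd_of_ne {d e : Fin 2 →₀ ℕ} (h : degWeight e = degWeight d)
    (hne : e ≠ d) : heckeMonomial d (deltaOdd (indexOf e)) = 0 := by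
  rw [degWeight, degWeight] at h
  rw [← Submodule.mem_bot (ZMod 2), ← weightLT_eq_bot le_rfl, heckeMonomial, indexOf,
    Module.End.mul_apply]
  rcases Nat.lt_or_ge (e 1) (d 1) with hlt | hge
  · refine weightLT_mono ?_
      (heckeThree_pow_mem_weightLT (heckeFive_pow_deltaOdd_of_lt hlt (e 0)) (d 0))
    omega
  · have hlt : e 0 < d 0 := by
      by_contra hcon
      refine hne (Finsupp.ext fun i => ?_)
      fin_cases i
      · change e 0 = d 0; omega
      · change e 1 = d 1; omega
    obtain ⟨m, hm⟩ := Nat.exists_eq_add_of_le' hge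
    have h1 := heckeThree_pow_mem_weightLT (heckeFive_pow_deltaOdd (d 1) (e 0) m) (d 0)
    have h2 := heckeThree_pow_deltaOdd_of_lt hlt m
    rw [map_sub] at h1
    have h3 := add_mem h1 h2
    rw [sub_add_cancel] at h3
    rw [hm]
    exact weightLT_mono (by omega) h3

theorem heckeThree_five_commute : Commute (heckeOp 3) (heckeOp 5) :=
  LinearMap.ext fun f => heckeOp_comm (by norm_num) (by norm_num) (by norm_num) f

theorem heckeMonomial_add (d e : Fin 2 →₀ ℕ) :
    heckeMonomial (d + e) = heckeMonomial d * heckeMonomial e := by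
  simp only [heckeMonomial, Finsupp.add_apply, pow_add]
  rw [mul_assoc, mul_assoc, ← mul_assoc (heckeOp 3 ^ e 0),
    ((heckeThree_five_commute.pow_pow (e 0) (d 1)).eq), mul_assoc]

theorem deltaOdd_mem_spaceF {i n : ℕ} (h : i < n) : deltaOdd i ∈ spaceF n :=
  Submodule.subset_span ⟨i, h, rfl⟩

theorem weight_le (i : ℕ) : weight i ≤ 2 * i := by
  induction i with
  | zero => simp [weight_zero]
  | succ i ih =>
    have := weight_add_le i 1
    rw [weight_one] at this
    omega

/-- Each factor lowers the weight by at least 2, and indices below n have weight below 2n. This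
nilpotence lets power series act on F(n). -/
theorem heckeMonomial_eq_zero {n : ℕ} {f : (ZMod 2)⟦X⟧} (hf : f ∈ spaceF n) {d : Fin 2 →₀ ℕ}
    (hd : n ≤ d 0 + d 1) : heckeMonomial d f = 0 := by
  have hf' : f ∈ weightLT (2 * n) := by
    refine Submodule.span_le.2 ?_ hf
    rintro f ⟨i, hi, rfl⟩
    have := weight_le i
    exact deltaOdd_mem_weightLT (by omega)
  have := heckeMonomial_mem_weightLT hf' d
  rwa [weightLT_eq_bot (by omega), Submodule.mem_bot] at this

theorem coeff_one_delta : coeff 1 Delta = 1 := by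
  simpa using coeff_self_delta_pow 1

/-- A form in the span of the odd powers of `Δ` is determined by the coefficients of `q` of its
images under the operators `T_3^a T_5^b`. -/
theorem eq_zero_of_coeff_one_heckeMonomial {n : ℕ} {f : (ZMod 2)⟦X⟧} (hf : f ∈ spaceF n)
    (h : ∀ d, coeff 1 (heckeMonomial d f) = 0) : f = 0 := by
  have hf' : f ∈ Submodule.span (ZMod 2) (Set.range fun d => deltaOdd (indexOf d)) := by
    refine Submodule.span_mono ?_ hf
    rintro f ⟨i, -, rfl⟩
    obtain ⟨d, rfl⟩ := exists_indexOf i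
    exact ⟨d, rfl⟩
  obtain ⟨c, rfl⟩ := Finsupp.mem_span_range_iff_exists_finsupp.1 hf'
  rcases c.support.eq_empty_or_nonempty with hc | hc
  · rw [Finsupp.support_eq_empty.1 hc, Finsupp.sum_zero_index]
  -- At a d of maximal weight in the support, `heckeMonomial d` kills every other term, so the
  -- coefficient of q isolates that of d.
  obtain ⟨d, hd, hmax⟩ := Finset.exists_max_image c.support degWeight hc
  exfalso
  refine Finsupp.mem_support_iff.1 hd ?_
  rw [← h d, Finsupp.sum, map_sum, map_sum, Finset.sum_eq_single d]
  · rw [map_smul, heckeMonomial_deltaOdd_self, map_smul, coeff_one_delta, smul_eq_mul, mul_one]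
  · intro e he hne
    have : heckeMonomial d (deltaOdd (indexOf e)) = 0 := by
      rcases (hmax e he).lt_or_eq with hlt | heq
      · exact heckeMonomial_deltaOdd_of_lt (by rwa [weight_indexOf])
      · exact heckeMonomial_deltaOdd_of_ne heq hne
    rw [map_smul, this, smul_zero, map_zero]
  · intro hd'
    exact absurd hd hd'

end HeckeModTwo

/-! ### Evaluation of power series, and `T_p` in the projective limit. -/

namespace HeckeModTwo

/-- Truncated Cauchy product: pairs in the box whose sum leaves it contribute nothing by `hN`. -/
theorem sum_sum_coeff_mul {S : Type*} [Ring S] [Algebra (ZMod 2) S] {m : (Fin 2 →₀ ℕ) → S}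
    (hadd : ∀ d e, m (d + e) = m d * m e) {N : Fin 2 →₀ ℕ}
    (hN : ∀ d, ¬ d ≤ N → m d = 0) (u v : SeriesXY) :
    ∑ k ∈ Finset.Iic N, MvPowerSeries.coeff k (u * v) • m k =
      (∑ d ∈ Finset.Iic N, MvPowerSeries.coeff d u • m d) *
        ∑ e ∈ Finset.Iic N, MvPowerSeries.coeff e v • m e := by
  classical
  have h1 (k : Fin 2 →₀ ℕ) : MvPowerSeries.coeff k (u * v) • m k =
      ∑ x ∈ Finset.HasAntidiagonal.antidiagonal k, (MvPowerSeries.coeff x.1 u • m x.1) *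
        (MvPowerSeries.coeff x.2 v • m x.2) := by
    rw [MvPowerSeries.coeff_mul, Finset.sum_smul]
    refine Finset.sum_congr rfl fun x hx => ?_
    rw [smul_mul_smul_comm, ← hadd, Finset.HasAntidiagonal.mem_antidiagonal.1 hx]
  rw [Finset.sum_congr rfl fun k _ => h1 k, Finset.sum_mul_sum, ← Finset.sum_product',
    Finset.sum_sigma']
  refine Finset.sum_of_injOn (fun x => x.2) ?_ ?_ ?_ ?_
  · rintro ⟨k, x⟩ hx ⟨l, y⟩ hy h
    simp only [Finset.mem_coe, Finset.mem_sigma, Finset.HasAntidiagonal.mem_antidiagonal] at hx hy h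
    obtain ⟨-, rfl⟩ := hx
    obtain ⟨-, rfl⟩ := hy
    subst h
    rfl
  · rintro ⟨k, x⟩ hx
    simp only [Finset.mem_coe, Finset.mem_sigma, Finset.HasAntidiagonal.mem_antidiagonal,
      Finset.mem_Iic, Finset.mem_product] at hx ⊢
    exact ⟨(le_add_of_nonneg_right (zero_le)).trans (hx.2.trans_le hx.1),
      (le_add_of_nonneg_left zero_le).trans (hx.2.trans_le hx.1)⟩
  · rintro ⟨d, e⟩ - h
    have : ¬ d + e ≤ N := fun hle => h ⟨⟨d + e, (d, e)⟩, by simpa using hle, rfl⟩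
    rw [smul_mul_smul_comm, ← hadd, hN _ this, smul_zero]
  · rintro ⟨k, x⟩ -
    rfl

/-- Evaluation of power series at a family of monomials which is zero outside a finite box. -/
noncomputable def evalBox {S : Type*} [Ring S] [Algebra (ZMod 2) S] (m : (Fin 2 →₀ ℕ) → S)
    (hzero : m 0 = 1) (hadd : ∀ d e, m (d + e) = m d * m e) (N : Fin 2 →₀ ℕ)
    (hN : ∀ d, ¬ d ≤ N → m d = 0) : SeriesXY →ₐ[ZMod 2] S where
  toFun u := ∑ d ∈ Finset.Iic N, MvPowerSeries.coeff d u • m d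
  map_one' := by
    classical
    rw [Finset.sum_eq_single 0]
    · simp [hzero]
    · intro d _ hd
      rw [MvPowerSeries.coeff_one, if_neg hd, zero_smul]
    · intro h
      exact absurd (Finset.mem_Iic.2 zero_le) h
  map_mul' := sum_sum_coeff_mul hadd hN
  map_zero' := by simp
  map_add' u v := by simp [add_smul, Finset.sum_add_distrib]
  commutes' r := by
    classical
    rw [Finset.sum_eq_single 0]
    · rw [MvPowerSeries.algebraMap_apply, MvPowerSeries.coeff_zero_C, hzero,
        Algebra.algebraMap_eq_smul_one, Algebra.algebraMap_eq_smul_one, smul_one_smul]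
    · intro d _ hd
      rw [MvPowerSeries.algebraMap_apply, MvPowerSeries.coeff_C, if_neg hd, zero_smul]
    · intro h
      exact absurd (Finset.mem_Iic.2 zero_le) h

open Classical in
/-- The endomorphism of `F(n)` induced by `T_p`, for `p` an odd prime. -/
noncomputable def heckeEnd (n p : ℕ) : Module.End (ZMod 2) (spaceF n) :=
  if h : p.Prime ∧ p ≠ 2 then
    (heckeOp p).restrict fun _ hf => heckeOp_mem_spaceF h.1 h.2 hf
  else 0

theorem isInducedHecke_heckeEnd (n : ℕ) {p : ℕ} (hp : p.Prime) (hp2 : p ≠ 2) :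
    IsInducedHecke p n (heckeEnd n p) := by
  intro f
  rw [heckeEnd, dif_pos ⟨hp, hp2⟩, LinearMap.coe_restrict_apply]

theorem heckeEnd_mem (n p : ℕ) : heckeEnd n p ∈ heckeAlg n := by
  by_cases h : p.Prime ∧ p ≠ 2
  · exact Algebra.subset_adjoin ⟨p, h.1, h.2, isInducedHecke_heckeEnd n h.1 h.2⟩
  · rw [heckeEnd, dif_neg h]
    exact zero_mem _

theorem mul_comm_of_mem_heckeAlg {n : ℕ} {s t : Module.End (ZMod 2) (spaceF n)}
    (hs : s ∈ heckeAlg n) (ht : t ∈ heckeAlg n) : s * t = t * s := by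
  have : IsMulCommutative (heckeAlg n) := by
    refine Algebra.isMulCommutative_adjoin _ ?_
    rintro x ⟨p, hp, hp2, hx⟩ y ⟨q, hq, hq2, hy⟩
    refine LinearMap.ext fun f => Subtype.ext ?_
    rw [Module.End.mul_apply, Module.End.mul_apply, hx, hy, hy, hx]
    rcases eq_or_ne p q with rfl | hpq
    · rfl
    · exact heckeOp_comm hp.pos hq.pos ((Nat.coprime_primes hp hq).2 hpq) f
  exact setLike_mul_comm hs ht

/-- `T_p` as an element of the projective limit, for `p` an odd prime. -/
noncomputable def heckeElt (p : ℕ) : heckeLim :=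
  ⟨fun n => heckeEnd n p, fun n => heckeEnd_mem n p, fun n f => by
    by_cases h : p.Prime ∧ p ≠ 2
    · refine Subtype.ext ?_
      rw [isInducedHecke_heckeEnd (n + 1) h.1 h.2]
      exact (isInducedHecke_heckeEnd n h.1 h.2 f).symm
    · simp [heckeEnd, dif_neg h]⟩

theorem isHecke_heckeElt {p : ℕ} (hp : p.Prime) (hp2 : p ≠ 2) : IsHecke p (heckeElt p) :=
  fun n => isInducedHecke_heckeEnd n hp hp2

end HeckeModTwo

/-! ### The isomorphism with `F₂[[x,y]]`. -/

namespace HeckeModTwo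

/-- The operator induced by `T_3^a T_5^b` on `F(n)`, for `d = (a, b)`. -/
noncomputable def monomialEnd (n : ℕ) (d : Fin 2 →₀ ℕ) : Module.End (ZMod 2) (spaceF n) :=
  heckeEnd n 3 ^ d 0 * heckeEnd n 5 ^ d 1

theorem coe_heckeEnd_pow {n p : ℕ} (hp : p.Prime) (hp2 : p ≠ 2) (k : ℕ) (f : spaceF n) :
    ((heckeEnd n p ^ k) f : (ZMod 2)⟦X⟧) = (heckeOp p ^ k) f := by
  induction k with
  | zero => rfl
  | succ k ih =>
    rw [pow_succ', pow_succ', Module.End.mul_apply, Module.End.mul_apply,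
      isInducedHecke_heckeEnd n hp hp2, ih]

theorem coe_monomialEnd {n : ℕ} (d : Fin 2 →₀ ℕ) (f : spaceF n) :
    (monomialEnd n d f : (ZMod 2)⟦X⟧) = heckeMonomial d f := by
  rw [monomialEnd, heckeMonomial, Module.End.mul_apply, Module.End.mul_apply,
    coe_heckeEnd_pow Nat.prime_three (by norm_num), coe_heckeEnd_pow Nat.prime_five (by norm_num)]

theorem monomialEnd_zero (n : ℕ) : monomialEnd n 0 = 1 := by
  simp [monomialEnd]

theorem monomialEnd_add {n : ℕ} (d e : Fin 2 →₀ ℕ) :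
    monomialEnd n (d + e) = monomialEnd n d * monomialEnd n e :=
  LinearMap.ext fun f => Subtype.ext (by
    rw [Module.End.mul_apply, coe_monomialEnd, coe_monomialEnd, coe_monomialEnd, heckeMonomial_add,
      Module.End.mul_apply])

theorem monomialEnd_mem (n : ℕ) (d : Fin 2 →₀ ℕ) : monomialEnd n d ∈ heckeAlg n :=
  mul_mem (pow_mem (heckeEnd_mem n 3) _) (pow_mem (heckeEnd_mem n 5) _)

theorem monomialEnd_eq_zero {n : ℕ} {d : Fin 2 →₀ ℕ} (hd : n ≤ d 0 + d 1) :
    monomialEnd n d = 0 :=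
  LinearMap.ext fun f => Subtype.ext (by
    rw [coe_monomialEnd, heckeMonomial_eq_zero f.2 hd]; rfl)

/-- The pair of exponents `(n, n)`. -/
noncomputable def box (n : ℕ) : Fin 2 →₀ ℕ := Finsupp.single 0 n + Finsupp.single 1 n

theorem le_box {n : ℕ} {d : Fin 2 →₀ ℕ} : d ≤ box n ↔ d 0 ≤ n ∧ d 1 ≤ n := by
  rw [Finsupp.le_def]
  simp [Fin.forall_fin_two, box]

theorem monomialEnd_eq_zero_of_not_le {n : ℕ} (d : Fin 2 →₀ ℕ) (hd : ¬ d ≤ box n) :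
    monomialEnd n d = 0 := by
  refine monomialEnd_eq_zero ?_
  rw [le_box] at hd
  omega

/-- The action of power series in `T_3` and `T_5` on `F(n)`. -/
noncomputable def seriesEnd (n : ℕ) : SeriesXY →ₐ[ZMod 2] Module.End (ZMod 2) (spaceF n) :=
  evalBox (monomialEnd n) (monomialEnd_zero n) monomialEnd_add (box n)
    monomialEnd_eq_zero_of_not_le

theorem seriesEnd_apply (n : ℕ) (u : SeriesXY) :
    seriesEnd n u = ∑ d ∈ Finset.Iic (box n), MvPowerSeries.coeff d u • monomialEnd n d :=
  rfl

/-- A larger box only adds monomials that kill f, so one sum serves F(n) and F(n+1); this is the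
compatibility with restriction. -/
theorem coe_seriesEnd {n k : ℕ} (h : n ≤ k) (u : SeriesXY) (f : spaceF n) :
    (seriesEnd n u f : (ZMod 2)⟦X⟧) =
      ∑ d ∈ Finset.Iic (box k), MvPowerSeries.coeff d u • heckeMonomial d f := by
  have h1 : (seriesEnd n u f : (ZMod 2)⟦X⟧) =
      ∑ d ∈ Finset.Iic (box n), MvPowerSeries.coeff d u • heckeMonomial d f := by
    rw [seriesEnd_apply, LinearMap.sum_apply, AddSubmonoidClass.coe_finsetSum]
    refine Finset.sum_congr rfl fun d _ => ?_
    rw [LinearMap.smul_apply, Submodule.coe_smul, coe_monomialEnd]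
  rw [h1]
  refine Finset.sum_subset (fun d hd => ?_) fun d _ hd => ?_
  · rw [Finset.mem_Iic, le_box] at hd ⊢
    omega
  · rw [Finset.mem_Iic, le_box] at hd
    rw [heckeMonomial_eq_zero f.2 (by omega), smul_zero]

theorem seriesEnd_mem (n : ℕ) (u : SeriesXY) : seriesEnd n u ∈ heckeAlg n := by
  rw [seriesEnd_apply]
  exact sum_mem fun d _ => (heckeAlg n).smul_mem (monomialEnd_mem n d) _

/-- The action of `F₂[[x,y]]` on all the `F(n)`, with `x` and `y` acting as `T_3` and `T_5`. -/
noncomputable def seriesHom : SeriesXY →ₐ[ZMod 2] heckeLim :=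
  AlgHom.codRestrict (AlgHom.pi seriesEnd) heckeLim fun u =>
    ⟨fun n => seriesEnd_mem n u, fun n f => Subtype.ext (by
      change (seriesEnd (n + 1) u _ : (ZMod 2)⟦X⟧) = seriesEnd n u f
      rw [coe_seriesEnd le_rfl, coe_seriesEnd n.le_succ]
      rfl)⟩

theorem seriesHom_apply (u : SeriesXY) (n : ℕ) : (seriesHom u).1 n = seriesEnd n u := rfl

theorem seriesHom_monomial_apply (e : Fin 2 →₀ ℕ) (n : ℕ) :
    (seriesHom (MvPowerSeries.monomial e 1)).1 n = monomialEnd n e := by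
  classical
  rw [seriesHom_apply, seriesEnd_apply, Finset.sum_eq_single e]
  · rw [MvPowerSeries.coeff_monomial_same, one_smul]
  · intro d _ hd
    rw [MvPowerSeries.coeff_monomial_ne hd, zero_smul]
  · intro h
    rw [Finset.mem_Iic] at h
    rw [monomialEnd_eq_zero_of_not_le e h, smul_zero]

theorem seriesHom_X_zero : seriesHom (MvPowerSeries.X 0) = heckeElt 3 := by
  refine Subtype.ext (funext fun n => ?_)
  rw [MvPowerSeries.X, seriesHom_monomial_apply]
  simp [monomialEnd, heckeElt]

theorem seriesHom_X_one : seriesHom (MvPowerSeries.X 1) = heckeElt 5 := by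
  refine Subtype.ext (funext fun n => ?_)
  rw [MvPowerSeries.X, seriesHom_monomial_apply]
  simp [monomialEnd, heckeElt]

theorem isContinuousHom_seriesHom : IsContinuousHom seriesHom := by
  refine fun n => ⟨n, fun u hu => ?_⟩
  rw [seriesHom_apply, seriesEnd_apply]
  refine Finset.sum_eq_zero fun d _ => ?_
  rcases Nat.lt_or_ge (d 0 + d 1) n with h | h
  · rw [hu d h, zero_smul]
  · rw [monomialEnd_eq_zero h, smul_zero]

/-- The coefficient of `q` in `T_3^a T_5^b Δ^(2i+1)`, where `d = (a, b)` and `e` is the pair of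
exponents with index `i`. -/
noncomputable def pairing (d e : Fin 2 →₀ ℕ) : ZMod 2 :=
  PowerSeries.coeff 1 (heckeMonomial d (deltaOdd (indexOf e)))

theorem pairing_self (d : Fin 2 →₀ ℕ) : pairing d d = 1 := by
  rw [pairing, heckeMonomial_deltaOdd_self, coeff_one_delta]

theorem pairing_eq_zero {d e : Fin 2 →₀ ℕ} (h : degWeight e ≤ degWeight d) (hne : d ≠ e) :
    pairing d e = 0 := by
  rw [pairing]
  rcases h.lt_or_eq with hlt | heq
  · rw [heckeMonomial_deltaOdd_of_lt (by rwa [weight_indexOf]), map_zero]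
  · rw [heckeMonomial_deltaOdd_of_ne heq hne.symm, map_zero]

/-- `Δ^(2i+1)` as an element of `F(i+1)`, with `i` the index of `e`. -/
noncomputable def deltaVec (e : Fin 2 →₀ ℕ) : spaceF (indexOf e + 1) :=
  ⟨deltaOdd (indexOf e), deltaOdd_mem_spaceF (Nat.lt_succ_self _)⟩

theorem mem_box_self (e : Fin 2 →₀ ℕ) : e ∈ Finset.Iic (box (indexOf e + 1)) := by
  rw [Finset.mem_Iic]
  by_contra h
  have h1 := heckeMonomial_deltaOdd_self e
  rw [← show (deltaVec e : (ZMod 2)⟦X⟧) = deltaOdd (indexOf e) from rfl, ← coe_monomialEnd,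
    monomialEnd_eq_zero_of_not_le e h] at h1
  have h2 := coeff_one_delta
  rw [← h1] at h2
  simp at h2

/-- The pairing of a power series with the odd powers of `Δ` is triangular. -/
theorem coeff_one_seriesEnd_deltaVec (u : SeriesXY) (e : Fin 2 →₀ ℕ) :
    PowerSeries.coeff 1 (seriesEnd _ u (deltaVec e) : (ZMod 2)⟦X⟧) = MvPowerSeries.coeff e u +
      ∑ d ∈ Finset.Iic (box (indexOf e + 1)) with degWeight d < degWeight e,
        MvPowerSeries.coeff d u * pairing d e := by
  have h1 : PowerSeries.coeff 1 (seriesEnd _ u (deltaVec e) : (ZMod 2)⟦X⟧) =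
      ∑ d ∈ Finset.Iic (box (indexOf e + 1)), MvPowerSeries.coeff d u * pairing d e := by
    rw [coe_seriesEnd le_rfl, map_sum]
    refine Finset.sum_congr rfl fun d _ => ?_
    rw [map_smul, smul_eq_mul]
    rfl
  rw [h1, ← Finset.sum_filter_add_sum_filter_not _ (fun d => degWeight d < degWeight e), add_comm]
  congr 1
  rw [Finset.sum_eq_single e]
  · rw [pairing_self, mul_one]
  · intro d hd hne
    rw [Finset.mem_filter, not_lt] at hd
    rw [pairing_eq_zero hd.2 hne, mul_zero]
  · intro h
    exact absurd (Finset.mem_filter.2 ⟨mem_box_self e, lt_irrefl _⟩) h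

/-- A triangular system with ones on the diagonal, solved by recursion on `degWeight`. -/
theorem exists_coeff_one_seriesEnd_eq (c : (Fin 2 →₀ ℕ) → ZMod 2) :
    ∃ u : SeriesXY, ∀ e,
      PowerSeries.coeff 1 (seriesEnd _ u (deltaVec e) : (ZMod 2)⟦X⟧) = c e := by
  classical
  let u : SeriesXY := (measure degWeight).wf.fix fun e rec =>
    c e - ∑ d ∈ Finset.Iic (box (indexOf e + 1)),
      if h : degWeight d < degWeight e then rec d h * pairing d e else 0
  refine ⟨u, fun e => ?_⟩
  have hu : MvPowerSeries.coeff e u = c e - ∑ d ∈ Finset.Iic (box (indexOf e + 1)),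
      if degWeight d < degWeight e then MvPowerSeries.coeff d u * pairing d e else 0 := by
    change u e = _
    rw [show u e = _ from WellFounded.fix_eq _ _ _]
    rfl
  rw [coeff_one_seriesEnd_deltaVec, hu, Finset.sum_filter, sub_add_cancel]

theorem seriesHom_injective : Function.Injective seriesHom := by
  rw [injective_iff_map_eq_zero]
  intro u hu
  ext e
  rw [map_zero]
  induction h : degWeight e using Nat.strong_induction_on generalizing e with
  | _ w ih =>
    subst h
    have h1 := coeff_one_seriesEnd_deltaVec u e
    rw [← seriesHom_apply, hu, Finset.sum_eq_zero, add_zero] at h1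
    · rw [← h1]
      simp
    · intro d hd
      rw [ih _ (Finset.mem_filter.1 hd).2 d rfl, zero_mul]

theorem heckeLim_apply_eq (a : heckeLim) {n k : ℕ} (hk : n ≤ k) {f : (ZMod 2)⟦X⟧}
    (hf : f ∈ spaceF n) (hf' : f ∈ spaceF k) :
    (a.1 n ⟨f, hf⟩ : (ZMod 2)⟦X⟧) = a.1 k ⟨f, hf'⟩ := by
  induction k, hk using Nat.le_induction with
  | base => rfl
  | succ k hk ih =>
    have hf'' : f ∈ spaceF k := (monotone_nat_of_le_succ spaceF_le_succ) hk hf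
    rw [ih hf'']
    exact (congrArg Subtype.val (a.2.2 k ⟨f, hf''⟩)).symm

/-- By commutativity the coefficient of q in m(a f), for a monomial m in T_3 and T_5, is the one in
a(m f). So the functionals f ↦ a₁(a f) determine all these coefficients, and hence a f. -/
theorem heckeLim_ext {a b : heckeLim}
    (h : ∀ e, PowerSeries.coeff 1 (a.1 _ (deltaVec e) : (ZMod 2)⟦X⟧) =
      PowerSeries.coeff 1 (b.1 _ (deltaVec e) : (ZMod 2)⟦X⟧)) : a = b := by
  have h2 (n : ℕ) : (PowerSeries.coeff 1 ∘ₗ (spaceF n).subtype) ∘ₗ a.1 n =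
      (PowerSeries.coeff 1 ∘ₗ (spaceF n).subtype) ∘ₗ b.1 n := by
    refine LinearMap.ext_on Submodule.span_span_coe_preimage ?_
    rintro ⟨f, hf⟩ ⟨i, hi, hfi⟩
    simp only at hfi
    subst hfi
    obtain ⟨e, rfl⟩ := exists_indexOf i
    have ha := heckeLim_apply_eq a hi (deltaVec e).2 hf
    have hb := heckeLim_apply_eq b hi (deltaVec e).2 hf
    exact ((congrArg (PowerSeries.coeff 1) ha).symm.trans (h e)).trans
      (congrArg (PowerSeries.coeff 1) hb)
  refine Subtype.ext (funext fun n => LinearMap.ext fun f => Subtype.ext (sub_eq_zero.1 ?_))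
  refine eq_zero_of_coeff_one_heckeMonomial (sub_mem (a.1 n f).2 (b.1 n f).2) fun d => ?_
  rw [map_sub, map_sub, ← coe_monomialEnd, ← coe_monomialEnd, ← Module.End.mul_apply,
    ← Module.End.mul_apply, mul_comm_of_mem_heckeAlg (monomialEnd_mem n d) (a.2.1 n),
    mul_comm_of_mem_heckeAlg (monomialEnd_mem n d) (b.2.1 n), Module.End.mul_apply,
    Module.End.mul_apply]
  exact sub_eq_zero.2 (LinearMap.congr_fun (h2 n) _)

theorem seriesHom_surjective : Function.Surjective seriesHom := by
  intro a
  obtain ⟨u, hu⟩ := exists_coeff_one_seriesEnd_eq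
    fun e => PowerSeries.coeff 1 (a.1 _ (deltaVec e) : (ZMod 2)⟦X⟧)
  exact ⟨u, heckeLim_ext hu⟩

end HeckeModTwo

/-! ### Residues mod 8 and the shape of `T_p`. -/

namespace HeckeModTwo

theorem HasResidue.heckeOp_pow {r : ZMod 8} {f : (ZMod 2)⟦X⟧} (hf : HasResidue r f) {p : ℕ}
    (hp : Odd p) (k : ℕ) : HasResidue (p ^ k * r) ((_root_.heckeOp p ^ k) f) := by
  induction k with
  | zero => simpa using hf
  | succ k ih =>
    rw [pow_succ', pow_succ', Module.End.mul_apply, mul_assoc]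
    exact ih.heckeOp hp

/-- The residue mod `8` of `3^a 5^b`, for `d = (a, b)`. -/
def degResidue (d : Fin 2 →₀ ℕ) : ZMod 8 := 3 ^ d 0 * 5 ^ d 1

theorem HasResidue.heckeMonomial {r : ZMod 8} {f : (ZMod 2)⟦X⟧} (hf : HasResidue r f)
    (d : Fin 2 →₀ ℕ) : HasResidue (degResidue d * r) (HeckeModTwo.heckeMonomial d f) := by
  have := (hf.heckeOp_pow (p := 5) (by decide) (d 1)).heckeOp_pow (p := 3) (by decide) (d 0)
  rw [← mul_assoc] at this
  exact this

theorem degResidue_eq (d : Fin 2 →₀ ℕ) : degResidue d = 3 ^ (d 0 % 2) * 5 ^ (d 1 % 2) := by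
  have h3 : (3 : ZMod 8) ^ 2 = 1 := by decide
  have h5 : (5 : ZMod 8) ^ 2 = 1 := by decide
  rw [degResidue, pow_eq_pow_mod (d 0) h3, pow_eq_pow_mod (d 1) h5]

theorem degResidue_mul_self (d : Fin 2 →₀ ℕ) : degResidue d * degResidue d = 1 := by
  rw [degResidue_eq]
  rcases Nat.mod_two_eq_zero_or_one (d 0) with h | h <;>
    rcases Nat.mod_two_eq_zero_or_one (d 1) with h' | h' <;> rw [h, h'] <;> decide

/-- T_3^a T_5^b Δ^k has its exponents in the class of 3^a 5^b k, which must be 1 for q to occur; 3^a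
5^b is its own inverse. -/
theorem degResidue_eq_of_pairing_ne_zero {d e : Fin 2 →₀ ℕ} (h : pairing d e ≠ 0) :
    degResidue d = (2 * indexOf e + 1 : ℕ) := by
  have h1 := (hasResidue_delta_pow (2 * indexOf e + 1)).heckeMonomial d 1 h
  rw [Nat.cast_one] at h1
  calc degResidue d = degResidue d * 1 := (mul_one _).symm
    _ = _ := by rw [h1, ← mul_assoc, degResidue_mul_self, one_mul]

/-- Induction on weight in the triangular formula, with k the exponent attached to e. The pairing of
T_p with Δ^k is the coefficient of q^p in Δ^k, zero unless k ≡ p. A correction term at d would need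
3^a 5^b ≡ p for d = (a, b) by induction and ≡ k by the pairing, so again k ≡ p; and k ≡ `degResidue
e`. -/
theorem degResidue_eq_of_coeff_ne_zero {p : ℕ} (hp : p.Prime) (hp2 : p ≠ 2) {u : SeriesXY}
    (hu : seriesHom u = heckeElt p) {e : Fin 2 →₀ ℕ} (he : MvPowerSeries.coeff e u ≠ 0) :
    degResidue e = p := by
  induction h : degWeight e using Nat.strong_induction_on generalizing e with
  | _ w ih =>
    subst h
    have hself : degResidue e = (2 * indexOf e + 1 : ℕ) :=
      degResidue_eq_of_pairing_ne_zero (by rw [pairing_self]; exact one_ne_zero)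
    by_contra hne
    have h1 := coeff_one_seriesEnd_deltaVec u e
    rw [← seriesHom_apply, hu, isHecke_heckeElt hp hp2, Finset.sum_eq_zero, add_zero,
      coeff_heckeOp, mul_one, if_neg (by simpa using hp.ne_one), add_zero] at h1
    · rw [← h1] at he
      exact hne (hself.trans (hasResidue_delta_pow _ p he).symm)
    · intro d hd
      by_contra hcon
      have h2 := ih _ (Finset.mem_filter.1 hd).2 (left_ne_zero_of_mul hcon) rfl
      rw [degResidue_eq_of_pairing_ne_zero (right_ne_zero_of_mul hcon), ← hself] at h2
      exact hne h2

theorem exists_evenSeries_of_parity {u : SeriesXY} {e : Fin 2 →₀ ℕ}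
    (he : ∀ i, e i < 2) (h : ∀ d, MvPowerSeries.coeff d u ≠ 0 → ∀ i, d i % 2 = e i) :
    ∃ v ∈ evenSeries, u = MvPowerSeries.monomial e 1 * v := by
  classical
  let w : SeriesXY := fun d => MvPowerSeries.coeff (e + 2 • d) u
  refine ⟨MvPowerSeries.expand (σ := Fin 2) (R := ZMod 2) 2 two_ne_zero w, ⟨w, rfl⟩, ?_⟩
  ext d
  by_cases hd : ∀ i, d i % 2 = e i
  · have hm : d = e + 2 • d.mapRange (· / 2) (Nat.zero_div 2) := by
      ext i
      have := hd i
      simp only [Finsupp.add_apply, Finsupp.smul_apply, Finsupp.mapRange_apply, smul_eq_mul]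
      omega
    rw [hm, MvPowerSeries.coeff_add_monomial_mul, one_mul]
    exact (MvPowerSeries.coeff_expand_smul (R := ZMod 2) 2 two_ne_zero w _).symm
  · have h0 : MvPowerSeries.coeff d u = 0 := by
      by_contra hcon
      exact hd (h d hcon)
    rw [h0, MvPowerSeries.coeff_monomial_mul]
    split_ifs with hle
    · push Not at hd
      obtain ⟨i, hi⟩ := hd
      have h1 := he i
      have h2 := hle i
      rw [one_mul]
      refine (MvPowerSeries.coeff_expand_of_not_dvd (R := ZMod 2) 2 two_ne_zero w (i := i) ?_).symm
      rw [Finsupp.tsub_apply]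
      omega
    · rfl

/-- Each class of odd residues mod 8 is 3^a 5^b for exactly one choice of a, b in {0, 1}, so p fixes
the parities of the exponents occurring in T_p. -/
theorem exists_evenSeries {p : ℕ} (hp : p.Prime) (hp2 : p ≠ 2) (e : Fin 2 →₀ ℕ)
    (he2 : ∀ i, e i < 2) (he : ∀ a < 2, ∀ b < 2, (3 : ZMod 8) ^ a * 5 ^ b = p →
      a = e 0 ∧ b = e 1) :
    ∃ v ∈ evenSeries, heckeElt p = seriesHom (MvPowerSeries.monomial e 1 * v) := by
  obtain ⟨u, hu⟩ := seriesHom_surjective (heckeElt p)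
  obtain ⟨v, hv, huv⟩ := exists_evenSeries_of_parity (u := u) he2 fun d hd i => by
    have h1 := degResidue_eq_of_coeff_ne_zero hp hp2 hu hd
    rw [degResidue_eq] at h1
    have h2 := he _ (Nat.mod_lt _ two_pos) _ (Nat.mod_lt _ two_pos) h1
    fin_cases i
    · exact h2.1
    · exact h2.2
  exact ⟨v, hv, by rw [← huv, hu]⟩

end HeckeModTwo

theorem mainTheorem9 :
    ∃ (T : ℕ → heckeLim) (ψ : SeriesXY ≃ₐ[ZMod 2] heckeLim),
      (∀ p : ℕ, p.Prime → p ≠ 2 → IsHecke p (T p)) ∧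
      IsContinuousHom (ψ : SeriesXY →ₐ[ZMod 2] heckeLim) ∧
      ψ (MvPowerSeries.X 0) = T 3 ∧
      ψ (MvPowerSeries.X 1) = T 5 ∧
      ∀ p : ℕ, p.Prime →
        (p ≡ 1 [MOD 8] → ∃ v ∈ evenSeries, T p = ψ v) ∧
        (p ≡ 3 [MOD 8] → ∃ v ∈ evenSeries, T p = ψ (MvPowerSeries.X 0 * v)) ∧
        (p ≡ 5 [MOD 8] → ∃ v ∈ evenSeries, T p = ψ (MvPowerSeries.X 1 * v)) ∧
        (p ≡ 7 [MOD 8] → ∃ v ∈ evenSeries,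
          T p = ψ (MvPowerSeries.X 0 * MvPowerSeries.X 1 * v)) := by
  refine ⟨HeckeModTwo.heckeElt, AlgEquiv.ofBijective HeckeModTwo.seriesHom
    ⟨HeckeModTwo.seriesHom_injective, HeckeModTwo.seriesHom_surjective⟩,
    fun p hp hp2 => HeckeModTwo.isHecke_heckeElt hp hp2, HeckeModTwo.isContinuousHom_seriesHom,
    HeckeModTwo.seriesHom_X_zero, HeckeModTwo.seriesHom_X_one, fun p hp => ?_⟩
  have hp2 {r : ℕ} (hr : r % 2 = 1) (h : p ≡ r [MOD 8]) : p ≠ 2 := by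
    rintro rfl
    have := h.of_dvd (show 2 ∣ 8 by norm_num)
    rw [Nat.ModEq, hr] at this
    exact absurd this (by decide)
  refine ⟨fun h => ?_, fun h => ?_, fun h => ?_, fun h => ?_⟩
  · have hr : (p : ZMod 8) = (1 : ℕ) := (ZMod.natCast_eq_natCast_iff _ _ _).2 h
    obtain ⟨v, hv, hpv⟩ := HeckeModTwo.exists_evenSeries hp (hp2 rfl h) 0
      (by simp) (by rw [hr]; simpa using by decide)
    refine ⟨v, hv, hpv.trans ?_⟩
    rw [MvPowerSeries.monomial_zero_one, one_mul]
    rfl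
  · have hr : (p : ZMod 8) = (3 : ℕ) := (ZMod.natCast_eq_natCast_iff _ _ _).2 h
    exact HeckeModTwo.exists_evenSeries hp (hp2 rfl h) (Finsupp.single 0 1)
      (by simp [Fin.forall_fin_two]) (by rw [hr]; simpa using by decide)
  · have hr : (p : ZMod 8) = (5 : ℕ) := (ZMod.natCast_eq_natCast_iff _ _ _).2 h
    exact HeckeModTwo.exists_evenSeries hp (hp2 rfl h) (Finsupp.single 1 1)
      (by simp [Fin.forall_fin_two]) (by rw [hr]; simpa using by decide)
  · have hr : (p : ZMod 8) = (7 : ℕ) := (ZMod.natCast_eq_natCast_iff _ _ _).2 h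
    obtain ⟨v, hv, hpv⟩ := HeckeModTwo.exists_evenSeries hp (hp2 rfl h)
      (Finsupp.single 0 1 + Finsupp.single 1 1) (by simp [Fin.forall_fin_two])
      (by rw [hr]; simpa using by decide)
    refine ⟨v, hv, hpv.trans ?_⟩
    rw [MvPowerSeries.X, MvPowerSeries.X, MvPowerSeries.monomial_mul_monomial, one_mul]
    rfl
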